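/- A pushdown automaton (PDA) accepting by final states is a tuple $P=(Q,\Sigma,\Gamma,\delta,q_0,Z_0,F)$ with a finite set $Q$ of states, an initial state $q_0\in Q$, a finite stack alphabet $\Gamma$, an initial stack symbol $Z_0\in\Gamma$, a set $F\subseteq Q$ of final states, and a finite set $\delta\subseteq Q\times\Gamma\times(\Sigma\cup\{\varepsilon\})\times Q\times\Gamma^*$ of actions. An action $(q,X,b,q',\beta)\in\delta$ allows the moves $(q,X\gamma)\vdash_b(q',\beta\gamma)$, $\gamma\in\Gamma^*$, and $P$ accepts $w\in\Sigma^*$ if some finite sequence of moves leads from $(q_0,Z_0)$ to some $(q,\beta)$ with $q\in F$ and $\beta\in\Gamma^*$ arbitrary, and consumes $w$. It is deterministic if for all $q\in Q$, $X\in\Gamma$ and $b\in\Sigma\cup\{\varepsilon\}$ there is at most one pair $(q',\beta)$ with $(q,X,b,q',\beta)\in\delta$, and if, whenever there is such a pair for $b=\varepsilon$, there is none for any $b\in\Sigma$. It is unary if $|\Sigma|=1$. Theorem. There are a constant $C$ and an algorithm that, given any unary deterministic PDA $P$ accepting by final states, computes in time polynomial in the size of $P$ a context-free grammar that generates exactly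 the language accepted by $P$ and has at most $C\,n\,p$ variables, where $n$ is the number of states and $p$ the number of stack symbols of $P$. -/

import Mathlib

/-! ### Pushdown automata -/

/-- An action `(q, X) ↪_b (q', β)`: in state `source` with `pop` on top of the stack, consume `input`
(`none` is the empty word `ε`), go to state `target` and replace the top symbol by the word `push`
(its first letter becomes the new top). -/
structure PDAAction (T Q G : Type) where
  source : Q
  pop : G
  input : Option T
  target : Q
  push : List G

/-- A pushdown automaton over the input alphabet `T`, with states `Fin numStates`, stack symbols
`Fin numSymbols`, an initial state, an initial stack symbol, a finite set of actions and a set of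
final states; the two sets are given by lists of their elements, and only membership in these lists
matters. -/
structure PDA (T : Type) where
  numStates : ℕ
  numSymbols : ℕ
  start : Fin numStates
  bottom : Fin numSymbols
  final : List (Fin numStates)
  actions : List (PDAAction T (Fin numStates) (Fin numSymbols))

namespace PDA

variable {T : Type}

/-- Instantaneous descriptions: a state and a stack content (top of the stack first). -/
abbrev ID (P : PDA T) : Type := Fin P.numStates × List (Fin P.numSymbols)

/-- `P.Move I b J`: some action of `P` leads from `I` to `J` in one move that consumes `b`. -/
def Move (P : PDA T) (I : P.ID) (b : Option T) (J : P.ID) : Prop :=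
  ∃ a ∈ P.actions, ∃ γ : List (Fin P.numSymbols),
    a.input = b ∧ I = (a.source, a.pop :: γ) ∧ J = (a.target, a.push ++ γ)

/-- `P.MoveSeq I w J`: there is a finite (possibly empty) move sequence from `I` to `J` that
consumes the word `w`. -/
inductive MoveSeq (P : PDA T) : P.ID → List T → P.ID → Prop
  | nil (I : P.ID) : MoveSeq P I [] I
  | cons {I J K : P.ID} {b : Option T} {w : List T} :
      P.Move I b J → MoveSeq P J w K → MoveSeq P I (b.toList ++ w) K

/-- The language that `P` accepts by final states: the words consumed by some move sequence from the
initial instantaneous description to one whose state is final, with arbitrary stack content. -/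
def language (P : PDA T) : Language T :=
  {w | ∃ q ∈ P.final, ∃ β : List (Fin P.numSymbols),
    P.MoveSeq (P.start, [P.bottom]) w (q, β)}

/-- Determinism: (i) for all `q`, `b`, `X` with `b` a letter or `ε` there is at most one action
`(q, X) ↪_b (q', β)`; (ii) if there is one with `b = ε`, then there is none with `b` a letter. -/
def Deterministic (P : PDA T) : Prop :=
  (∀ a ∈ P.actions, ∀ a' ∈ P.actions,
    a.source = a'.source → a.pop = a'.pop → a.input = a'.input → a = a') ∧
  (∀ a ∈ P.actions, ∀ a' ∈ P.actions,
    a.source = a'.source → a.pop = a'.pop → a.input = none → a'.input = none)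

end PDA

/-- Unary deterministic pushdown automata: the input alphabet has exactly one letter. -/
abbrev UDPDA : Type := {P : PDA Unit // P.Deterministic}

/-! ### Finite descriptions of context-free grammars -/

/-- A description of a context-free grammar over the alphabet `T` with variables `Fin numVars`; the
finite set of rules is given by a list of its elements. -/
structure CFGDescr (T : Type) where
  numVars : ℕ
  initial : Fin numVars
  rules : List (ContextFreeRule T (Fin numVars))

/-- The context-free grammar that is described. -/
def CFGDescr.toCFG {T : Type} [DecidableEq T] (G : CFGDescr T) : ContextFreeGrammar T where
  NT := Fin G.numVars
  initial := G.initial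
  rules := G.rules.toFinset

/-! ### Encodings as words over a finite alphabet -/

/-- The alphabet of the input and output words of the algorithm. -/
inductive Tok : Type
  | one | sep | cons | nil | letter | eps | var

namespace Tok

/-- A number in unary, with an end marker. -/
def encNum (k : ℕ) : List Tok := List.replicate k Tok.one ++ [Tok.sep]

/-- A list of encoded items. -/
def encList {α : Type} (e : α → List Tok) : List α → List Tok
  | [] => [Tok.nil]
  | x :: xs => Tok.cons :: (e x ++ encList e xs)

/-- The input letter of an action over a one-letter alphabet, or `ε`. -/
def encInput : Option Unit → List Tok
  | none => [Tok.eps]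
  | some _ => [Tok.letter]

/-- An action of a unary pushdown automaton. -/
def encAction {n p : ℕ} (a : PDAAction Unit (Fin n) (Fin p)) : List Tok :=
  encNum a.source ++ (encNum a.pop ++ (encInput a.input ++
    (encNum a.target ++ encList (fun X : Fin p => encNum X) a.push)))

/-- A unary pushdown automaton. -/
def encPDA (P : PDA Unit) : List Tok :=
  encNum P.numStates ++ (encNum P.numSymbols ++ (encNum P.start ++ (encNum P.bottom ++
    (encList (fun q : Fin P.numStates => encNum q) P.final ++ encList encAction P.actions))))

/-- A unary deterministic pushdown automaton. -/
def encUDPDA (P : UDPDA) : List Tok := encPDA P.1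

/-- A symbol on the right-hand side of a rule over a one-letter alphabet. -/
def encSymbol {v : ℕ} : Symbol Unit (Fin v) → List Tok
  | Symbol.terminal _ => [Tok.letter]
  | Symbol.nonterminal X => Tok.var :: encNum X

/-- A rule over a one-letter alphabet. -/
def encRule {v : ℕ} (r : ContextFreeRule Unit (Fin v)) : List Tok :=
  encNum r.input ++ encList encSymbol r.output

/-- A context-free grammar over a one-letter alphabet. -/
def encCFG (G : CFGDescr Unit) : List Tok :=
  encNum G.numVars ++ (encNum G.initial ++ encList encRule G.rules)

/-- `e` is a prefix code: an encoded item can be read off the front of a word in only one way. -/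
def PrefixCode {α : Type} (e : α → List Tok) : Prop :=
  ∀ (x y : α) (u v : List Tok), e x ++ u = e y ++ v → x = y ∧ u = v

theorem prefixCode_encNum : PrefixCode encNum := by
  intro x
  induction x with
  | zero => intro y u v h; cases y <;> simp_all [encNum, List.replicate_succ]
  | succ k ih =>
    intro y u v h
    cases y with
    | zero => simp [encNum, List.replicate_succ] at h
    | succ m =>
      have := ih m u v (by simpa [encNum, List.replicate_succ] using h)
      exact ⟨by rw [this.1], this.2⟩

theorem prefixCode_encFin (n : ℕ) : PrefixCode (fun q : Fin n => encNum q) := by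
  intro x y u v h
  have := prefixCode_encNum _ _ _ _ h
  exact ⟨Fin.ext this.1, this.2⟩

theorem PrefixCode.encList {α : Type} {e : α → List Tok} (he : PrefixCode e) :
    PrefixCode (encList e) := by
  intro x
  induction x with
  | nil => intro y u v h; cases y <;> simp_all [Tok.encList]
  | cons a l ih =>
    intro y u v h
    cases y with
    | nil => simp [Tok.encList] at h
    | cons b m =>
      simp only [Tok.encList, List.cons_append, List.cons.injEq, true_and, List.append_assoc] at h
      obtain ⟨rfl, k1⟩ := he _ _ _ _ h
      obtain ⟨rfl, k2⟩ := ih _ _ _ k1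
      exact ⟨rfl, k2⟩

theorem prefixCode_encAction (n p : ℕ) : PrefixCode (encAction (n := n) (p := p)) := by
  rintro ⟨q, X, b, q', β⟩ ⟨r, Y, c, r', β'⟩ u v h
  simp only [encAction, List.append_assoc] at h
  obtain ⟨h1, k1⟩ := prefixCode_encFin _ _ _ _ _ h
  obtain ⟨h2, k2⟩ := prefixCode_encFin _ _ _ _ _ k1
  have h3 : PrefixCode encInput := by
    rintro (_ | _) (_ | _) u v h <;> simp_all [encInput]
  obtain ⟨h3, k3⟩ := h3 _ _ _ _ k2
  obtain ⟨h4, k4⟩ := prefixCode_encFin _ _ _ _ _ k3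
  obtain ⟨h5, k5⟩ := (prefixCode_encFin _).encList _ _ _ _ k4
  subst h1 h2 h3 h4 h5
  exact ⟨rfl, k5⟩

/-- The encoding of automata is injective. -/
theorem encPDA_injective : Function.Injective encPDA := by
  rintro ⟨n, p, q, Z, F, A⟩ ⟨n', p', q', Z', F', A'⟩ h
  simp only [encPDA] at h
  obtain ⟨rfl, k1⟩ := prefixCode_encNum _ _ _ _ h
  obtain ⟨rfl, k2⟩ := prefixCode_encNum _ _ _ _ k1
  obtain ⟨rfl, k3⟩ := prefixCode_encFin _ _ _ _ _ k2
  obtain ⟨rfl, k4⟩ := prefixCode_encFin _ _ _ _ _ k3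
  obtain ⟨rfl, k5⟩ := (prefixCode_encFin _).encList _ _ _ _ k4
  obtain ⟨rfl, -⟩ := (prefixCode_encAction _ _).encList _ _ [] [] (by simpa using k5)
  rfl

theorem prefixCode_encRule (v : ℕ) : PrefixCode (encRule (v := v)) := by
  rintro ⟨X, α⟩ ⟨Y, β⟩ u w h
  simp only [encRule, List.append_assoc] at h
  obtain ⟨h1, k1⟩ := prefixCode_encFin _ _ _ _ _ h
  have h2 : PrefixCode (encSymbol (v := v)) := by
    rintro (_ | a) (_ | b) u w h
    · simp_all [encSymbol]
    · simp [encSymbol] at h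
    · simp [encSymbol] at h
    · simp only [encSymbol, List.cons_append, List.cons.injEq, true_and] at h
      obtain ⟨rfl, k2⟩ := prefixCode_encFin _ _ _ _ _ h
      exact ⟨rfl, k2⟩
  obtain ⟨h2, k3⟩ := h2.encList _ _ _ _ k1
  subst h1 h2
  exact ⟨rfl, k3⟩

/-- The encoding of grammars is injective. -/
theorem encCFG_injective : Function.Injective encCFG := by
  rintro ⟨n, q, A⟩ ⟨n', q', A'⟩ h
  simp only [encCFG] at h
  obtain ⟨rfl, k1⟩ := prefixCode_encNum _ _ _ _ h
  obtain ⟨rfl, k2⟩ := prefixCode_encFin _ _ _ _ _ k1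
  obtain ⟨rfl, -⟩ := (prefixCode_encRule _).encList _ _ [] [] (by simpa using k2)
  rfl

end Tok

/-!
A pushdown automaton that is deterministic and unary has, as long as it does not get stuck, only one
computation. Hence for each state `q` and each stack symbol `X` there is at most one state in which a
computation from `q` can pop `X`, and the triples of the usual conversion to a context-free grammar
can be replaced by pairs: the variable `varPop q X` generates the input of the computation that
starts in `q` and pops `X`, and the variable `varAcc q X` generates the inputs of the computations
that start in `q` with the stack `X` and lead to a final state before `X` has been popped. An action
`(q, X) ↪_b (q', Y₁ ⋯ Yₘ)` yields the rules `varPop q X → b varPop q₁ Y₁ ⋯ varPop qₘ Yₘ` and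
`varAcc q X → b varPop q₁ Y₁ ⋯ varPop qᵢ Yᵢ varAcc qᵢ₊₁ Yᵢ₊₁`, where `q₁ = q'` and `qᵢ₊₁` is the
state in which `Yᵢ` is popped from `qᵢ`. Together with a start variable these are `2np + 1 ≤ 3np`
variables.

The states `qᵢ` are determined by the exit function, the least fixed point of a monotone operator
`improve` on partial functions; it is reached within as many iterations as there are actions
(`improve_exits`). For the correctness of the grammar it only matters that the exit function is a
fixed point: `ClosedUnder.of_mem_language` shows that every assignment of languages to the variables
that is closed under the rules contains the accepted words, and `closedUnder_meaning` that sets of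
words read by computations of the automaton form such an assignment.

For the time bound, stack machines are programmed in a small structured language (`Prog`), which is
translated to multi-stack Turing machines step by step (`Run.simulate`). Data are binary trees, stored
in preorder on one stack, so that a program can treat its topmost trees as arguments without looking
at what lies below. The functions computed by such programs in polynomial time (`PolyFn`) are closed
under composition, pairing, case distinction (`PolyFn.branch`) and iteration along a list whose states
remain of polynomial size (`PolyFn.foldl`). The parser, the construction of the grammar and the
printer are assembled from these operations.
-/

/-! ### Structured programs on stacks -/

/-- The stacks of the machines below: `io` carries the input and, at the end, the output, `data` is
the working stack, `ctr` a counter, and the others are scratch space. -/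
inductive Stk : Type
  | io | data | ctr | s1 | s2 | s3
  deriving DecidableEq

namespace Stk

instance : Fintype Stk :=
  ⟨⟨[io, data, ctr, s1, s2, s3], by simp⟩, by rintro (_ | _) <;> simp⟩

end Stk

instance : Finite Tok :=
  Finite.of_injective
    (fun t : Tok => match t with
      | .one => (0 : Fin 7) | .sep => 1 | .cons => 2 | .nil => 3
      | .letter => 4 | .eps => 5 | .var => 6)
    (by rintro (_ | _) (_ | _) h <;> simp_all)

/-- The contents of all stacks, the top first. -/
abbrev Store : Type := Stk → List Tok

/-- Structured programs on stacks. `pop k f` pops `k` and goes on with `f o`, where `o` is the popped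
symbol (`none` if `k` was empty). `loop k quit body` pops `k` again and again, and executes `body a`
for each popped symbol `a`, until `k` is empty or the popped symbol satisfies `quit`. -/
inductive Prog : Type
  | skip : Prog
  | push (k : Stk) (a : Tok) : Prog
  | pop (k : Stk) (f : Option Tok → Prog) : Prog
  | seq (p q : Prog) : Prog
  | loop (k : Stk) (quit : Tok → Bool) (body : Tok → Prog) : Prog

/-- `Run p s t s'`: the program `p`, started with the stack contents `s`, terminates after exactly
`t` steps with the stack contents `s'`. -/
inductive Run : Prog → Store → ℕ → Store → Prop
  | skip (s) : Run .skip s 1 s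
  | push (k a s) : Run (.push k a) s 1 (Function.update s k (a :: s k))
  | pop {k f s t s'} : Run (f (s k).head?) (Function.update s k (s k).tail) t s' →
      Run (.pop k f) s (t + 1) s'
  | seq {p q s t s' t' s''} : Run p s t s' → Run q s' t' s'' → Run (.seq p q) s (t + t') s''
  | loopNil {k quit body s} : s k = [] →
      Run (.loop k quit body) s 1 s
  | loopStop {k quit body s a l} : s k = a :: l → quit a = true →
      Run (.loop k quit body) s 1 (Function.update s k l)
  | loopStep {k quit body s a l t s' t' s''} : s k = a :: l → quit a = false →
      Run (body a) (Function.update s k l) t s' → Run (.loop k quit body) s' t' s'' →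
      Run (.loop k quit body) s (t + t' + 1) s''

namespace Prog

/-- The control points of a program. -/
def Lab : Prog → Type
  | skip => Unit
  | push _ _ => Unit
  | pop _ f => Option (Σ o, Lab (f o))
  | seq p q => Lab p ⊕ Lab q
  | loop _ _ b => Option (Σ a, Lab (b a))

instance finite_lab (p : Prog) : Finite (Lab p) := by
  induction p with
  | skip => exact inferInstanceAs (Finite Unit)
  | push _ _ => exact inferInstanceAs (Finite Unit)
  | pop k f ih => exact inferInstanceAs (Finite (Option (Σ o, Lab (f o))))
  | seq p q _ _ => exact inferInstanceAs (Finite (Lab p ⊕ Lab q))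
  | loop k s b ih => exact inferInstanceAs (Finite (Option (Σ a, Lab (b a))))

/-- The control point at which the execution of a program begins. -/
def entry : (p : Prog) → Lab p
  | skip => ()
  | push _ _ => ()
  | pop _ _ => none
  | seq p _ => Sum.inl (entry p)
  | loop _ _ _ => none

/-- The statements of a multi-stack machine that executes a program whose control points are
embedded into the labels `Λ` of the machine by `e`, and that continues at the label `x` afterwards.
The internal state of the machine is the symbol popped last. -/
def instr {Λ : Type} : (p : Prog) → (Lab p → Λ) → Λ → Lab p →
    Turing.TM2.Stmt (fun _ : Stk => Tok) Λ (Option Tok)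
  | skip, _, x, _ => .goto fun _ => x
  | push k a, _, x, _ => .push k (fun _ => a) (.goto fun _ => x)
  | pop k f, e, _, none => .pop k (fun _ o => o) (.goto fun v => e (some ⟨v, entry (f v)⟩))
  | pop _ f, e, x, some ⟨o, l⟩ => instr (f o) (fun l => e (some ⟨o, l⟩)) x l
  | seq p q, e, _, .inl l => instr p (fun l => e (.inl l)) (e (.inr (entry q))) l
  | seq _ q, e, x, .inr l => instr q (fun l => e (.inr l)) x l
  | loop k quit b, e, x, none => .pop k (fun _ o => o) (.goto fun v =>
      match v with
      | none => x
      | some a => if quit a then x else e (some ⟨a, entry (b a)⟩))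
  | loop _ _ b, e, _, some ⟨a, l⟩ => instr (b a) (fun l => e (some ⟨a, l⟩)) (e none) l

end Prog

/-- A machine that contains the statements of a program simulates its runs, step by step. -/
theorem Run.simulate {Λ : Type} (M : Λ → Turing.TM2.Stmt (fun _ : Stk => Tok) Λ (Option Tok))
    {p : Prog} {s s' : Store} {t : ℕ} (h : Run p s t s') :
    ∀ (e : p.Lab → Λ) (x : Λ), (∀ l, M (e l) = p.instr e x l) → ∀ v, ∃ v',
      (flip bind (Turing.TM2.step M))^[t] (some ⟨some (e p.entry), v, s⟩) =
        some ⟨some x, v', s'⟩ := by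
  have step (l v s) : flip bind (Turing.TM2.step M) (some ⟨some l, v, s⟩) =
    some (Turing.TM2.stepAux (M l) v s) := rfl
  induction h with
  | skip s =>
    intro e x hM v
    exact ⟨v, (step _ _ _).trans (by rw [hM]; rfl)⟩
  | push k a s =>
    intro e x hM v
    exact ⟨v, (step _ _ _).trans (by rw [hM]; rfl)⟩
  | @pop k f s t s' _ ih =>
    intro e x hM v
    obtain ⟨v', hv'⟩ := ih (fun l => e (some ⟨_, l⟩)) x (fun l => hM _) (s k).head?
    refine ⟨v', ?_⟩
    rw [Function.iterate_succ_apply, ← hv', step, hM]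
    rfl
  | @seq p q s t s' t' s'' _ _ ih ih' =>
    intro e x hM v
    obtain ⟨v', hv'⟩ := ih (fun l => e (.inl l)) (e (.inr q.entry)) (fun l => hM _) v
    obtain ⟨w, hw⟩ := ih' (fun l => e (.inr l)) x (fun l => hM _) v'
    refine ⟨w, ?_⟩
    rw [Nat.add_comm, Function.iterate_add_apply, ← hw, ← hv']
    rfl
  | @loopNil k quit body s hs =>
    intro e x hM v
    refine ⟨none, (step _ _ _).trans ?_⟩
    rw [hM]
    simp only [Prog.entry, Prog.instr, Turing.TM2.stepAux, hs, List.head?_nil, List.tail_nil]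
    rw [← hs, Function.update_eq_self]
  | @loopStop k quit body s a l hs ha =>
    intro e x hM v
    refine ⟨some a, (step _ _ _).trans ?_⟩
    rw [hM]
    simp only [Prog.entry, Prog.instr, Turing.TM2.stepAux, hs, List.head?_cons, List.tail_cons, ha,
      if_true]
  | @loopStep k quit body s a l t s' t' s'' hs ha _ _ ih ih' =>
    intro e x hM v
    obtain ⟨v', hv'⟩ := ih (fun l => e (some ⟨a, l⟩)) (e none) (fun l => hM _) (some a)
    obtain ⟨w, hw⟩ := ih' e x hM v'
    refine ⟨w, ?_⟩
    rw [Function.iterate_succ_apply, Nat.add_comm, Function.iterate_add_apply, ← hw, step, hM]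
    simp only [Prog.entry, Prog.instr, Turing.TM2.stepAux, hs, List.head?_cons, List.tail_cons, ha,
      Bool.false_eq_true, if_false]
    exact congrArg _ hv'

/-- The store with the given contents. -/
def st (i d c x y z : List Tok) : Store
  | .io => i
  | .data => d
  | .ctr => c
  | .s1 => x
  | .s2 => y
  | .s3 => z

/-- The store with the given contents of `io` and `data` and all other stacks empty. -/
abbrev mem (i d : List Tok) : Store := st i d [] [] [] []

/-- The machine that executes a program and halts. -/
noncomputable def Prog.machine (p : Prog) : Turing.FinTM2 where
  K := Stk
  k₀ := .io
  k₁ := .io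
  Γ _ := Tok
  Λ := Option p.Lab
  main := some p.entry
  ΛFin := Fintype.ofFinite _
  σ := Option Tok
  initialState := none
  σFin := Fintype.ofFinite _
  Γk₀Fin := Fintype.ofFinite _
  m l := match l with
    | some l => p.instr some none l
    | none => .load (fun _ => none) .halt

/-- A program that computes `f` on the stack `io` within polynomial time yields a polynomial-time
machine for `f`. -/
theorem Prog.computableInPolyTime {α β : Type} {ea : α → List Tok} {eb : β → List Tok} {f : α → β}
    (p : Prog) (q : Polynomial ℕ)
    (h : ∀ a, ∃ t ≤ q.eval (ea a).length, Run p (mem (ea a) []) t (mem (eb (f a)) [])) :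
    Nonempty (Turing.TM2ComputableInPolyTime ea eb f) := by
  have hinit (l : List Tok) : Turing.initList p.machine l =
      ⟨some (some p.entry), none, mem l []⟩ := by
    change Turing.TM2.Cfg.mk _ _ _ = Turing.TM2.Cfg.mk _ _ _
    congr 1
    funext k
    cases k <;> rfl
  have hhalt (l : List Tok) : Turing.haltList p.machine l = ⟨none, none, mem l []⟩ := by
    change Turing.TM2.Cfg.mk _ _ _ = Turing.TM2.Cfg.mk _ _ _
    congr 1
    funext k
    cases k <;> rfl
  refine ⟨⟨⟨p.machine, Equiv.refl Tok, Equiv.refl Tok⟩, q + 1, fun a => ?_⟩⟩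
  have hex := h a
  refine ⟨⟨hex.choose + 1, ?_⟩, ?_⟩
  · obtain ⟨v, hv⟩ := hex.choose_spec.2.simulate p.machine.m some none (fun l => rfl) none
    have e1 : List.map (Equiv.refl Tok).invFun (ea a) = ea a := List.map_id _
    have e2 : List.map (Equiv.refl Tok).invFun (eb (f a)) = eb (f a) := List.map_id _
    rw [Function.iterate_succ_apply']
    refine (congrArg (fun c => flip bind p.machine.step
      ((flip bind p.machine.step)^[hex.choose] (some c)))
        ((congrArg (Turing.initList p.machine) e1).trans (hinit _))).trans ?_
    refine (congrArg (flip bind p.machine.step) hv).trans ?_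
    refine Eq.trans ?_ (congrArg some
      ((congrArg (Turing.haltList p.machine) e2).trans (hhalt _))).symm
    rfl
  · have := hex.choose_spec.1
    simp only [Polynomial.eval_add, Polynomial.eval_one]
    exact Nat.add_le_add_right this 1

/-! ### Binary trees on the working stack -/

/-- Binary trees, the universal data type of the programs below. -/
inductive Dat : Type
  | leaf : Dat
  | node (a b : Dat) : Dat

namespace Dat

/-- The preorder traversal of a tree. It is a prefix code, so that several trees can be stored on a
stack one below the other. -/
def code : Dat → List Tok
  | leaf => [.nil]
  | node a b => .cons :: (code a ++ code b)

/-- The number of vertices of a tree. -/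
def size : Dat → ℕ
  | leaf => 1
  | node a b => size a + size b + 1

theorem length_code (d : Dat) : d.code.length = d.size := by
  induction d with
  | leaf => rfl
  | node a b iha ihb => simp [code, size, iha, ihb]

theorem size_pos (d : Dat) : 0 < d.size := by cases d <;> simp [size]

end Dat

/-- `RunIn p s T s'`: the program `p`, started with the stack contents `s`, terminates within `T`
steps with the stack contents `s'`. -/
def RunIn (p : Prog) (s : Store) (T : ℕ) (s' : Store) : Prop := ∃ t ≤ T, Run p s t s'

namespace RunIn

theorem mono {p s T T' s'} (h : RunIn p s T s') (hT : T ≤ T') : RunIn p s T' s' :=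
  let ⟨t, ht, hr⟩ := h
  ⟨t, ht.trans hT, hr⟩

theorem skip (s) : RunIn .skip s 1 s := ⟨1, le_rfl, .skip s⟩

theorem push {k : Stk} {a s s'} (h : Function.update s k (a :: s k) = s') : RunIn (.push k a) s 1 s' :=
  ⟨1, le_rfl, h ▸ .push k a s⟩

theorem pop {k : Stk} {f s o s₁ T s'} (ho : (s k).head? = o) (hs : Function.update s k (s k).tail = s₁)
    (h : RunIn (f o) s₁ T s') : RunIn (.pop k f) s (T + 1) s' := by
  obtain ⟨t, ht, hr⟩ := h
  subst ho hs
  exact ⟨t + 1, by omega, .pop hr⟩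

theorem seq {p q s s' s'' T T'} (h : RunIn p s T s') (h' : RunIn q s' T' s'') :
    RunIn (.seq p q) s (T + T') s'' := by
  obtain ⟨t, ht, hr⟩ := h
  obtain ⟨t', ht', hr'⟩ := h'
  exact ⟨t + t', by omega, .seq hr hr'⟩

theorem loopNil {k : Stk} {quit body s} (h : s k = []) : RunIn (.loop k quit body) s 1 s :=
  ⟨1, le_rfl, .loopNil h⟩

theorem loopStop {k : Stk} {quit body s a l s'} (h : s k = a :: l) (ha : quit a = true)
    (hs : Function.update s k l = s') : RunIn (.loop k quit body) s 1 s' :=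
  ⟨1, le_rfl, hs ▸ .loopStop h ha⟩

theorem loopStep {k : Stk} {quit body s a l s₁ s₂ s' T T'} (h : s k = a :: l) (ha : quit a = false)
    (hs : Function.update s k l = s₁) (hb : RunIn (body a) s₁ T s₂)
    (hl : RunIn (.loop k quit body) s₂ T' s') : RunIn (.loop k quit body) s (T + T' + 1) s' := by
  obtain ⟨t, ht, hr⟩ := hb
  obtain ⟨t', ht', hr'⟩ := hl
  subst hs
  exact ⟨t + t' + 1, by omega, .loopStep h ha hr hr'⟩

end RunIn

section update

variable (i d c x y z l : List Tok)

@[simp] theorem update_st_io : Function.update (st i d c x y z) .io l = st l d c x y z := by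
  funext k; cases k <;> rfl
@[simp] theorem update_st_data : Function.update (st i d c x y z) .data l = st i l c x y z := by
  funext k; cases k <;> rfl
@[simp] theorem update_st_s1 : Function.update (st i d c x y z) .s1 l = st i d c l y z := by
  funext k; cases k <;> rfl
@[simp] theorem update_st_s2 : Function.update (st i d c x y z) .s2 l = st i d c x l z := by
  funext k; cases k <;> rfl
@[simp] theorem update_st_s3 : Function.update (st i d c x y z) .s3 l = st i d c x y l := by
  funext k; cases k <;> rfl

end update

namespace Prog

/-- Transfer all symbols of one stack to another one, in reverse order. -/
def transfer (k k' : Stk) : Prog := .loop k (fun _ => false) (fun a => .push k' a)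

theorem runIn_transfer {k k' : Stk} (hk : k ≠ k') (l : List Tok) : ∀ s : Store, s k = l →
    RunIn (transfer k k') s (2 * l.length + 1)
      (Function.update (Function.update s k []) k' (l.reverse ++ s k')) := by
  induction l with
  | nil =>
    intro s hs
    have : Function.update (Function.update s k []) k' (List.reverse [] ++ s k') = s := by
      rw [← hs, Function.update_eq_self, hs, List.reverse_nil, List.nil_append,
        Function.update_eq_self]
    rw [this]
    exact RunIn.loopNil hs
  | cons a l ih =>
    intro s hs
    have e : Function.update (Function.update s k []) k' ((a :: l).reverse ++ s k') =
        Function.update (Function.update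
          (Function.update (Function.update s k l) k' (a :: Function.update s k l k')) k []) k'
          (l.reverse ++ Function.update (Function.update s k l) k'
            (a :: Function.update s k l k') k') := by
      funext j
      by_cases h1 : j = k'
      · subst h1; simp [hk.symm]
      · by_cases h2 : j = k
        · subst h2; simp [h1]
        · simp [h1, h2]
    rw [e]
    refine (RunIn.loopStep hs rfl rfl (RunIn.push rfl) (ih _ (by simp [hk]))).mono ?_
    simp; omega

/-- Remove the topmost tree from the working stack, with its code reversed onto the stack `j`. The
counter holds one symbol for each subtree that is still to be read. -/
def grab (j : Stk) : Prog :=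
  .seq (.push .ctr .one) (.loop .ctr (fun _ => false) fun _ => .pop .data fun
    | some .cons => .seq (.push j .cons) (.seq (.push .ctr .one) (.push .ctr .one))
    | some a => .push j a
    | none => .skip)

end Prog

/-- The store `s` with new contents of the counter, of `data` and of `j`. -/
def upd (s : Store) (j : Stk) (c r l : List Tok) : Store := fun k =>
  if k = j then l else if k = .data then r else if k = .ctr then c else s k

theorem runIn_grab_loop {j : Stk} (h1 : j ≠ .data) (h2 : j ≠ .ctr) (s : Store) (d : Dat) :
    ∀ (c r l : List Tok) (T : ℕ) (F : Store),
    let L : Prog := .loop .ctr (fun _ => false) fun _ => .pop .data fun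
      | some .cons => .seq (.push j .cons) (.seq (.push .ctr .one) (.push .ctr .one))
      | some a => .push j a
      | none => .skip
    RunIn L (upd s j c r (d.code.reverse ++ l)) T F →
      RunIn L (upd s j (.one :: c) (d.code ++ r) l) (T + 5 * d.size) F := by
  have e1 (c r l x) : Function.update (upd s j c r l) j x = upd s j c r x := by
    funext k; by_cases h : k = j <;> simp [upd, Function.update, h]
  have e2 (c r l x) : Function.update (upd s j c r l) .data x = upd s j c x l := by
    funext k; by_cases h : k = .data <;> simp [upd, Function.update, h, h1.symm]
  have e3 (c r l x) : Function.update (upd s j c r l) .ctr x = upd s j x r l := by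
    funext k; by_cases h : k = .ctr <;> simp [upd, Function.update, h, h2.symm]
  have g1 (c r l) : upd s j c r l j = l := by simp [upd]
  have g2 (c r l) : upd s j c r l .data = r := by simp [upd, h1.symm]
  have g3 (c r l) : upd s j c r l .ctr = c := by simp [upd, h2.symm]
  induction d with
  | leaf =>
    intro c r l T F L h
    refine (RunIn.loopStep (g3 _ _ _) rfl (e3 _ _ _ _)
      (RunIn.pop (o := some .nil) (by rw [g2]; rfl) (e2 _ _ _ _) (RunIn.push (e1 _ _ _ _)))
      (by simpa [g1, g2, Dat.code] using h)).mono ?_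
    simp [Dat.size]; omega
  | node a b iha ihb =>
    intro c r l T F L h
    have hb := ihb c r (a.code.reverse ++ .cons :: l) T F (by simpa [Dat.code] using h)
    have ha := iha (.one :: c) (b.code ++ r) (.cons :: l) _ F hb
    refine (RunIn.loopStep (g3 _ _ _) rfl (e3 _ _ _ _)
      (RunIn.pop (o := some .cons) (by rw [g2]; rfl) (e2 _ _ _ _)
        (RunIn.seq (RunIn.push (e1 _ _ _ _))
          (RunIn.seq (RunIn.push (e3 _ _ _ _)) (RunIn.push (e3 _ _ _ _)))))
      (by simpa [g1, g2, g3, Dat.code] using ha)).mono ?_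
    simp [Dat.size]; omega

theorem runIn_grab {j : Stk} (h1 : j ≠ .data) (h2 : j ≠ .ctr) {s : Store} {d : Dat} {r : List Tok}
    (hd : s .data = d.code ++ r) (hc : s .ctr = []) :
    RunIn (Prog.grab j) s (7 * d.size)
      (Function.update (Function.update s .data r) j (d.code.reverse ++ s j)) := by
  have hpos := d.size_pos
  have e : upd s j [] r (d.code.reverse ++ s j) =
      Function.update (Function.update s .data r) j (d.code.reverse ++ s j) := by
    funext k
    simp only [upd, Function.update, eq_rec_constant, dite_eq_ite]
    split_ifs <;> simp_all
  refine (RunIn.seq (RunIn.push ?_) (runIn_grab_loop h1 h2 s d [] r (s j) 1 _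
    (e ▸ RunIn.loopNil (by simp [upd, h2.symm])))).mono (by omega)
  funext k
  simp only [upd, Function.update, eq_rec_constant, dite_eq_ite]
  split_ifs <;> simp_all

namespace Prog

/-- Transfer all symbols of `s1` to `data` and to `s2`, in reverse order. -/
def split : Prog := .loop .s1 (fun _ => false) (fun a => .seq (.push .data a) (.push .s2 a))

/-- Remove the topmost tree. -/
def drop : Prog := .seq (grab .s1) (.loop .s1 (fun _ => false) (fun _ => .skip))

/-- Duplicate the topmost tree. -/
def dup : Prog := .seq (grab .s1) (.seq split (.seq (transfer .s2 .s1) (transfer .s1 .data)))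

/-- Exchange the two topmost trees. -/
def swap : Prog :=
  .seq (grab .s1) (.seq (grab .s2) (.seq (transfer .s1 .data) (transfer .s2 .data)))

/-- Exchange the second and the third tree. -/
def swapBelow : Prog :=
  .seq (grab .s1) (.seq (grab .s2) (.seq (grab .s3)
    (.seq (transfer .s2 .data) (.seq (transfer .s3 .data) (transfer .s1 .data)))))

end Prog

section Trees

variable {i r x y z : List Tok}

theorem runIn_grab_s1 (d : Dat) :
    RunIn (Prog.grab .s1) (st i (d.code ++ r) [] x y z) (7 * d.size)
      (st i r [] (d.code.reverse ++ x) y z) := by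
  simpa [st] using runIn_grab (j := .s1) (by simp) (by simp) (s := st i (d.code ++ r) [] x y z)
    (d := d) (r := r) rfl rfl

theorem runIn_grab_s2 (d : Dat) :
    RunIn (Prog.grab .s2) (st i (d.code ++ r) [] x y z) (7 * d.size)
      (st i r [] x (d.code.reverse ++ y) z) := by
  simpa [st] using runIn_grab (j := .s2) (by simp) (by simp) (s := st i (d.code ++ r) [] x y z)
    (d := d) (r := r) rfl rfl

theorem runIn_grab_s3 (d : Dat) :
    RunIn (Prog.grab .s3) (st i (d.code ++ r) [] x y z) (7 * d.size)
      (st i r [] x y (d.code.reverse ++ z)) := by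
  simpa [st] using runIn_grab (j := .s3) (by simp) (by simp) (s := st i (d.code ++ r) [] x y z)
    (d := d) (r := r) rfl rfl

theorem runIn_release_s1 (d : Dat) :
    RunIn (.transfer .s1 .data) (st i r [] d.code.reverse y z) (2 * d.size + 1)
      (st i (d.code ++ r) [] [] y z) := by
  simpa [st, Dat.length_code] using
    Prog.runIn_transfer (k := .s1) (k' := .data) (by simp) _ (st i r [] d.code.reverse y z) rfl

theorem runIn_release_s2 (d : Dat) :
    RunIn (.transfer .s2 .data) (st i r [] x d.code.reverse z) (2 * d.size + 1)
      (st i (d.code ++ r) [] x [] z) := by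
  simpa [st, Dat.length_code] using
    Prog.runIn_transfer (k := .s2) (k' := .data) (by simp) _ (st i r [] x d.code.reverse z) rfl

theorem runIn_release_s3 (d : Dat) :
    RunIn (.transfer .s3 .data) (st i r [] x y d.code.reverse) (2 * d.size + 1)
      (st i (d.code ++ r) [] x y []) := by
  simpa [st, Dat.length_code] using
    Prog.runIn_transfer (k := .s3) (k' := .data) (by simp) _ (st i r [] x y d.code.reverse) rfl

theorem runIn_split (l : List Tok) : ∀ r y,
    RunIn .split (st i r [] l y z) (3 * l.length + 1)
      (st i (l.reverse ++ r) [] [] (l.reverse ++ y) z) := by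
  induction l with
  | nil => intro r y; exact RunIn.loopNil rfl
  | cons a l ih =>
    intro r y
    refine (RunIn.loopStep (s₂ := st i (a :: r) [] l (a :: y) z) rfl rfl (update_st_s1 ..)
      (RunIn.seq (RunIn.push (update_st_data ..)) (RunIn.push (update_st_s2 ..)))
      (by simpa [Prog.split] using ih (a :: r) (a :: y))).mono ?_
    simp; omega

theorem runIn_drop (d : Dat) : RunIn .drop (mem i (d.code ++ r)) (10 * d.size) (mem i r) := by
  have hpos := d.size_pos
  have clear (l : List Tok) : RunIn (.loop .s1 (fun _ => false) (fun _ => .skip))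
      (st i r [] l [] []) (2 * l.length + 1) (mem i r) := by
    induction l with
    | nil => exact RunIn.loopNil rfl
    | cons a l ih =>
      refine (RunIn.loopStep rfl rfl (update_st_s1 ..) (RunIn.skip _) ih).mono ?_
      simp; omega
  refine (RunIn.seq (runIn_grab_s1 d) (clear _)).mono ?_
  simp [Dat.length_code]; omega

theorem runIn_dup (d : Dat) :
    RunIn .dup (mem i (d.code ++ r)) (17 * d.size) (mem i (d.code ++ (d.code ++ r))) := by
  have hpos := d.size_pos
  have h1 : RunIn (.transfer .s2 .s1) (st i (d.code ++ r) [] [] d.code []) (2 * d.size + 1)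
      (st i (d.code ++ r) [] d.code.reverse [] []) := by
    simpa [st, Dat.length_code] using Prog.runIn_transfer (k := .s2) (k' := .s1) (by simp) _
      (st i (d.code ++ r) [] [] d.code []) rfl
  refine (RunIn.seq (runIn_grab_s1 d) (RunIn.seq (runIn_split _ _ _) (RunIn.seq
    (by simpa using h1) (runIn_release_s1 d)))).mono ?_
  simp [Dat.length_code]; omega

theorem runIn_swap (a b : Dat) :
    RunIn .swap (mem i (a.code ++ (b.code ++ r))) (10 * (a.size + b.size))
      (mem i (b.code ++ (a.code ++ r))) := by
  have ha := a.size_pos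
  have hb := b.size_pos
  refine (RunIn.seq (runIn_grab_s1 a) (RunIn.seq (runIn_grab_s2 b) (RunIn.seq
    (by simpa using runIn_release_s1 a) (by simpa using runIn_release_s2 b)))).mono ?_
  omega

theorem runIn_swapBelow (a b c : Dat) :
    RunIn .swapBelow (mem i (a.code ++ (b.code ++ (c.code ++ r))))
      (10 * (a.size + b.size + c.size)) (mem i (a.code ++ (c.code ++ (b.code ++ r)))) := by
  have ha := a.size_pos
  have hb := b.size_pos
  have hc := c.size_pos
  refine (RunIn.seq (runIn_grab_s1 a) (RunIn.seq (runIn_grab_s2 b) (RunIn.seq (runIn_grab_s3 c)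
    (RunIn.seq (by simpa using runIn_release_s2 b) (RunIn.seq (by simpa using runIn_release_s3 c)
    (by simpa using runIn_release_s1 a)))))).mono ?_
  omega

end Trees

/-! ### Functions computable in polynomial time -/

/-- Types whose elements are represented by binary trees. -/
class Enc (α : Type) where
  /-- The tree that represents an element. -/
  enc : α → Dat

open Enc

/-- The size of the representation of an element. -/
def csize {α : Type} [Enc α] (a : α) : ℕ := (enc a).size

instance : Enc Dat := ⟨id⟩

instance : Enc Unit := ⟨fun _ => .leaf⟩

instance : Enc Bool := ⟨fun b => if b then .node .leaf .leaf else .leaf⟩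

/-- The unary representation of a number. -/
def encNat : ℕ → Dat
  | 0 => .leaf
  | n + 1 => .node .leaf (encNat n)

instance : Enc ℕ := ⟨encNat⟩

section

variable {α β : Type} [Enc α] [Enc β]

instance : Enc (α × β) := ⟨fun x => .node (enc x.1) (enc x.2)⟩

/-- The representation of a list, with its elements as the left children of the nodes on the
rightmost branch. -/
def encDatList : List α → Dat
  | [] => .leaf
  | a :: l => .node (enc a) (encDatList l)

instance : Enc (List α) := ⟨encDatList⟩

instance : Enc (Option α) := ⟨fun o => match o with
  | none => .leaf
  | some a => .node (enc a) .leaf⟩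

end

/-- The tokens, numbered. -/
def Tok.index : Tok → ℕ
  | .one => 0 | .sep => 1 | .cons => 2 | .nil => 3 | .letter => 4 | .eps => 5 | .var => 6

instance : Enc Tok := ⟨fun t => enc t.index⟩

theorem csize_pos {α : Type} [Enc α] (a : α) : 0 < csize a := Dat.size_pos _

/-- A function is computable in polynomial time if some program replaces the topmost tree of the
working stack, which represents an argument, by the tree that represents the value, leaving the
contents `r` below it unchanged, within a time that is polynomial in the size of the argument and does
not depend on `r`. The size of the value is required to obey the same bound. -/
@[fun_prop]
def PolyFn {α β : Type} [Enc α] [Enc β] (f : α → β) : Prop :=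
  ∃ (p : Prog) (q : Polynomial ℕ), ∀ a,
    (∀ r, RunIn p (mem [] ((enc a).code ++ r)) (q.eval (csize a)) (mem [] ((enc (f a)).code ++ r))) ∧
    csize (f a) ≤ q.eval (csize a)

theorem Polynomial.eval_le_eval_of_le (q : Polynomial ℕ) {a b : ℕ} (h : a ≤ b) :
    q.eval a ≤ q.eval b := by
  rw [Polynomial.eval_eq_sum, Polynomial.eval_eq_sum]
  exact Finset.sum_le_sum fun i _ => Nat.mul_le_mul_left _ (Nat.pow_le_pow_left h i)

namespace PolyFn

variable {α β γ σ κ : Type} [Enc α] [Enc β] [Enc γ] [Enc σ] [Enc κ]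

/-- Functions that do not change the representation cost nothing. -/
theorem recode {f : α → β} (h : ∀ a, enc (f a) = enc a) : PolyFn f :=
  ⟨.skip, .X + 1, fun a => ⟨fun r => h a ▸ (RunIn.skip _).mono (by simp), by simp [csize, h]⟩⟩

@[fun_prop]
theorem id : PolyFn (fun a : α => a) := recode fun _ => rfl

/-- Two functions with the same representations of arguments and values are both computable or
both not. -/
theorem congr_enc {f : α → β} {g : α → γ} (hf : PolyFn f) (h : ∀ a, enc (g a) = enc (f a)) :
    PolyFn g := by
  obtain ⟨p, q, hp⟩ := hf
  exact ⟨p, q, fun a => by simpa only [csize, h] using hp a⟩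

@[fun_prop]
theorem comp {g : β → γ} {f : α → β} (hg : PolyFn g) (hf : PolyFn f) :
    PolyFn (fun a => g (f a)) := by
  obtain ⟨p, q, hp⟩ := hf
  obtain ⟨p', q', hp'⟩ := hg
  refine ⟨.seq p p', q + q'.comp q, fun a => ⟨fun r => ?_, ?_⟩⟩
  · refine (RunIn.seq ((hp a).1 r) ((hp' (f a)).1 r)).mono ?_
    simpa using q'.eval_le_eval_of_le (hp a).2
  · have h1 := (hp' (f a)).2
    have h2 := q'.eval_le_eval_of_le (hp a).2
    simp only [Polynomial.eval_add, Polynomial.eval_comp]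
    omega

@[fun_prop]
theorem prodMk {f : α → β} {g : α → γ} (hf : PolyFn f) (hg : PolyFn g) :
    PolyFn (fun a => (f a, g a)) := by
  obtain ⟨p, q, hp⟩ := hf
  obtain ⟨p', q', hp'⟩ := hg
  refine ⟨.seq .dup (.seq p' (.seq .swap (.seq p (.push .data .cons)))),
    27 * .X + 11 * q' + q + 1, fun a => ⟨fun r => ?_, ?_⟩⟩
  · refine (RunIn.seq (runIn_dup _) (RunIn.seq ((hp' a).1 _) (RunIn.seq (runIn_swap _ _)
      (RunIn.seq ((hp a).1 _) (RunIn.push ?_))))).mono ?_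
    · simp [st, enc, Dat.code]
    · have := (hp' a).2
      simp only [Polynomial.eval_add, Polynomial.eval_mul, Polynomial.eval_ofNat, Polynomial.eval_X,
        Polynomial.eval_one]
      simp only [csize] at *
      omega
  · have h1 := (hp a).2
    have h2 := (hp' a).2
    simp only [Polynomial.eval_add, Polynomial.eval_mul, Polynomial.eval_ofNat, Polynomial.eval_X,
        Polynomial.eval_one]
    simp only [csize, enc, Dat.size] at *
    omega

theorem fst' : PolyFn (fun x : α × β => x.1) := by
  refine ⟨.pop .data fun _ => .seq .swap .drop, 20 * .X + 1, fun x => ⟨fun r => ?_, ?_⟩⟩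
  · have e : mem [] ((enc x).code ++ r) =
        mem [] (.cons :: ((enc x.1).code ++ ((enc x.2).code ++ r))) := by simp [enc, Dat.code]
    rw [e]
    refine (RunIn.pop rfl (update_st_data ..)
      (RunIn.seq (runIn_swap _ _) (runIn_drop _))).mono ?_
    simp [csize, enc, Dat.size]
    omega
  · simp [csize, enc, Dat.size]
    omega

theorem snd' : PolyFn (fun x : α × β => x.2) := by
  refine ⟨.pop .data fun _ => .drop, 20 * .X + 1, fun x => ⟨fun r => ?_, ?_⟩⟩
  · have e : mem [] ((enc x).code ++ r) =
        mem [] (.cons :: ((enc x.1).code ++ ((enc x.2).code ++ r))) := by simp [enc, Dat.code]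
    rw [e]
    refine (RunIn.pop rfl (update_st_data ..) (runIn_drop _)).mono ?_
    simp [csize, enc, Dat.size]
    omega
  · simp [csize, enc, Dat.size]
    omega

@[fun_prop]
theorem fst {f : α → β × γ} (hf : PolyFn f) : PolyFn (fun a => (f a).1) := fst'.comp hf

@[fun_prop]
theorem snd {f : α → β × γ} (hf : PolyFn f) : PolyFn (fun a => (f a).2) := snd'.comp hf

@[fun_prop]
theorem const (b : β) : PolyFn (fun _ : α => b) := by
  have push_list (l : List Tok) : ∃ p : Prog, ∀ r, RunIn p (mem [] r) (l.length + 1)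
      (mem [] (l ++ r)) := by
    induction l with
    | nil => exact ⟨.skip, fun r => RunIn.skip _⟩
    | cons a l ih =>
      obtain ⟨p, hp⟩ := ih
      exact ⟨.seq p (.push .data a), fun r =>
        (RunIn.seq (hp r) (RunIn.push (update_st_data ..))).mono (by simp)⟩
  obtain ⟨p, hp⟩ := push_list (enc b).code
  refine ⟨.seq .drop p, 10 * .X + (.C (csize b) + 1), fun a => ⟨fun r => ?_, ?_⟩⟩
  · refine (RunIn.seq (runIn_drop _) (hp r)).mono ?_
    simp [csize, Dat.length_code]
  · simp
    omega

/-- Case distinction on the root of the representation of `c x`. In the case of a node the subtrees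
represent `a` and `b`. -/
theorem branch {δ ε : Type} [Enc δ] [Enc ε] {c : α → κ} {f : α → γ} {g : α × δ × ε → γ} {h : α → γ}
    (hc : PolyFn c) (hf : PolyFn f) (hg : PolyFn g)
    (H : ∀ x, (enc (c x) = .leaf ∧ h x = f x) ∨
      ∃ a b, enc (c x) = .node (enc a) (enc b) ∧ h x = g (x, a, b)) : PolyFn h := by
  obtain ⟨pc, qc, hpc⟩ := hc
  obtain ⟨pf, qf, hpf⟩ := hf
  obtain ⟨pg, qg, hpg⟩ := hg
  refine ⟨.seq .dup (.seq pc (.pop .data fun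
      | some .cons => .seq (.push .data .cons) (.seq .swap (.seq (.push .data .cons) pg))
      | _ => pf)),
    27 * .X + 11 * qc + 3 + qf + qg.comp (.X + qc + 1), fun x => ?_⟩
  have hcx := (hpc x).2
  simp only [Polynomial.eval_add, Polynomial.eval_mul, Polynomial.eval_ofNat, Polynomial.eval_X,
        Polynomial.eval_one, Polynomial.eval_comp]
  obtain ⟨h1, h2⟩ | ⟨a, b, h1, h2⟩ := H x
  · refine ⟨fun r => ?_, ?_⟩
    · refine (RunIn.seq (runIn_dup _) (RunIn.seq ((hpc x).1 _) (RunIn.pop (o := some .nil) ?_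
        (update_st_data ..) (T := qf.eval (csize x)) ?_))).mono ?_
      · simp [st, h1, Dat.code]
      · simpa [st, h1, h2, Dat.code] using (hpf x).1 r
      · simp only [csize]
        omega
    · rw [h2]
      have := (hpf x).2
      omega
  · have hs : csize (x, a, b) ≤ csize x + qc.eval (csize x) + 1 := by
      have e : csize (c x) = csize (a, b) := congrArg Dat.size h1
      have e' : csize (x, a, b) = csize x + csize (a, b) + 1 := rfl
      omega
    have hs' := qg.eval_le_eval_of_le hs
    refine ⟨fun r => ?_, ?_⟩
    · refine (RunIn.seq (runIn_dup _) (RunIn.seq ((hpc x).1 _) (RunIn.pop (o := some .cons) ?_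
        (update_st_data ..) (RunIn.seq (RunIn.push (update_st_data ..)) (RunIn.seq
          (s' := mem [] ((enc x).code ++ ((enc (a, b)).code ++ r))) (T := 10 * (csize (a, b) + csize x))
          ?_ (RunIn.seq (RunIn.push (update_st_data ..)) ?_)))))).mono
            (T := 17 * csize x + (qc.eval (csize x) + ((1 + (10 * (csize (a, b) + csize x) +
              (1 + qg.eval (csize (x, a, b))))) + 1))) ?_
      · simp [st, h1, Dat.code]
      · simpa [st, h1, Dat.code, enc, csize] using runIn_swap (i := []) (enc (a, b)) (enc x) (r := r)
      · simpa [st, h2, Dat.code, enc] using (hpg (x, a, b)).1 r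
      · have e : csize (c x) = csize (a, b) := congrArg Dat.size h1
        omega
    · rw [h2]
      have := (hpg (x, a, b)).2
      omega

/-- The program that runs through a list, which lies on top of the current state, and applies `p` to
the pairs of an element and the state. -/
def _root_.Prog.fold (p : Prog) : Prog :=
  .loop .data (fun a => match a with | .cons => false | _ => true) fun _ =>
    .seq .swapBelow (.seq (.push .data .cons) (.seq p .swap))

theorem runIn_fold {step : β × σ → σ} {p : Prog} {q : Polynomial ℕ}
    (hp : ∀ a r, RunIn p (mem [] ((enc a).code ++ r)) (q.eval (csize a))
      (mem [] ((enc (step a)).code ++ r)))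
    (B L : ℕ) (l : List β) (hL : csize l ≤ L) (r : List Tok) : ∀ s : σ,
    (∀ l', l' <+: l → csize (l'.foldl (fun s a => step (a, s)) s) ≤ B) →
    RunIn p.fold (mem [] ((enc l).code ++ ((enc s).code ++ r)))
      (l.length * (20 * (L + B) + q.eval (L + B + 1) + 2) + 1)
      (mem [] ((enc (l.foldl (fun s a => step (a, s)) s)).code ++ r)) := by
  induction l with
  | nil =>
    intro s hB
    exact (RunIn.loopStop rfl rfl (update_st_data ..)).mono (by simp)
  | cons a l ih =>
    intro s hB
    have hs : csize s ≤ B := hB [] (by simp)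
    have hs' : csize (step (a, s)) ≤ B := hB [a] (by simp)
    have hl : csize (a :: l) = csize a + csize l + 1 := rfl
    have hq : q.eval (csize (a, s)) ≤ q.eval (L + B + 1) := q.eval_le_eval_of_le (by
      have : csize (a, s) = csize a + csize s + 1 := rfl
      omega)
    have e : (enc (a :: l)).code ++ ((enc s).code ++ r) =
        .cons :: ((enc a).code ++ ((enc l).code ++ ((enc s).code ++ r))) := by
      simp [enc, encDatList, Dat.code]
    rw [e]
    have h1 := hp (a, s) ((enc l).code ++ r)
    have hi := ih (by omega) (step (a, s)) fun l' hl' => by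
      simpa using hB (a :: l') (by simpa using hl')
    refine (RunIn.loopStep rfl rfl (update_st_data ..) (RunIn.seq (runIn_swapBelow _ _ _)
      (RunIn.seq (RunIn.push (update_st_data ..)) (RunIn.seq (T := q.eval (csize (a, s)))
      (by simpa [enc, Dat.code, st] using h1) (runIn_swap _ _)))) hi).mono ?_
    simp only [List.length_cons, Nat.add_mul, Nat.one_mul]
    simp only [csize] at *
    omega

theorem length_le_csize (l : List β) : l.length < csize l := by
  induction l with
  | nil => simp [csize, enc, encDatList, Dat.size]
  | cons a l ih =>
    have : csize (a :: l) = csize a + csize l + 1 := rfl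
    simp
    omega

/-- Iteration along a list, if all states that occur have polynomial size. -/
theorem foldl {l : α → List β} {init : α → σ} {step : α → σ → β → σ}
    (hl : PolyFn l) (hi : PolyFn init) (hs : PolyFn fun x : (α × σ) × β => step x.1.1 x.1.2 x.2)
    (hq : ∃ q : Polynomial ℕ, ∀ x l', l' <+: l x →
      csize (l'.foldl (step x) (init x)) ≤ q.eval (csize x)) :
    PolyFn fun x => (l x).foldl (step x) (init x) := by
  obtain ⟨q, hq⟩ := hq
  have hstep : PolyFn fun y : β × (α × σ) => (y.2.1, step y.2.1 y.2.2 y.1) := by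
    have := hs.comp (f := fun y : β × (α × σ) => (y.2, y.1)) (by fun_prop)
    exact prodMk (by fun_prop) this
  have key (x : α) (l : List β) : ∀ s : σ, l.foldl
      (fun (s : α × σ) (a : β) => (fun y : β × (α × σ) => (y.2.1, step y.2.1 y.2.2 y.1)) (a, s)) (x, s) =
        (x, l.foldl (step x) s) := by
    induction l with
    | nil => intro s; rfl
    | cons a l ih => intro s; exact ih _
  have main : PolyFn fun x => (x, (l x).foldl (step x) (init x)) := by
    obtain ⟨p, qp, hp⟩ := hstep
    have h0 : PolyFn fun x => (l x, (x, init x)) := by fun_prop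
    obtain ⟨p0, q0, hp0⟩ := h0
    let B : Polynomial ℕ := .X + q + 1
    refine ⟨.seq p0 (.pop .data fun _ => p.fold),
      q0 + 1 + (q0 * (20 * (q0 + B) + qp.comp (q0 + B + 1) + 2) + 1) + B, fun x => ⟨fun r => ?_, ?_⟩⟩
    · have h1 : csize (l x, (x, init x)) ≤ _ := (hp0 x).2
      have h2 : csize (l x, (x, init x)) = csize (l x) + csize (x, init x) + 1 := rfl
      have h3 := length_le_csize (l x)
      have := runIn_fold (fun a => (hp a).1) (B.eval (csize x)) (q0.eval (csize x)) (l x) (by omega) r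
        (x, init x) fun l' hl' => by
          rw [key]
          have e : csize (x, l'.foldl (step x) (init x)) =
            csize x + csize (l'.foldl (step x) (init x)) + 1 := rfl
          have := hq x l' hl'
          simp only [B, Polynomial.eval_add, Polynomial.eval_X, Polynomial.eval_one]
          omega
      rw [key] at this
      refine (RunIn.seq ((hp0 x).1 r) (RunIn.pop (by rfl) (update_st_data ..) ?_)).mono
        (T := q0.eval (csize x) + (((l x).length * (20 * (q0.eval (csize x) + B.eval (csize x)) +
          qp.eval (q0.eval (csize x) + B.eval (csize x) + 1) + 2) + 1) + 1)) ?_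
      · simpa [st, enc, Dat.code] using this
      · simp only [Polynomial.eval_add, Polynomial.eval_mul, Polynomial.eval_ofNat,
          Polynomial.eval_one, Polynomial.eval_comp]
        have : (l x).length ≤ q0.eval (csize x) := by omega
        have := Nat.mul_le_mul_right (20 * (q0.eval (csize x) + B.eval (csize x)) +
          qp.eval (q0.eval (csize x) + B.eval (csize x) + 1) + 2) this
        omega
    · have := hq x (l x) (List.prefix_refl _)
      have e : csize (x, (l x).foldl (step x) (init x)) =
            csize x + csize ((l x).foldl (step x) (init x)) + 1 := rfl
      simp only [B, Polynomial.eval_add, Polynomial.eval_X, Polynomial.eval_one]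
      omega
  exact main.snd

end PolyFn

/-! ### A library of functions computable in polynomial time -/

namespace PolyFn

variable {α β γ σ : Type} [Enc α] [Enc β] [Enc γ] [Enc σ]

theorem bound {f : α → β} (hf : PolyFn f) :
    ∃ q : Polynomial ℕ, ∀ a, csize (f a) ≤ q.eval (csize a) :=
  let ⟨_, q, h⟩ := hf
  ⟨q, fun a => (h a).2⟩

theorem csize_prod (a : α) (b : β) : csize (a, b) = csize a + csize b + 1 := rfl

theorem csize_cons (a : α) (l : List α) : csize (a :: l) = csize a + csize l + 1 := rfl

theorem csize_nil : csize ([] : List α) = 1 := rfl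

theorem csize_some (a : α) : csize (some a) = csize a + 2 := rfl

theorem csize_none : csize (none : Option α) = 1 := rfl

theorem csize_nat (n : ℕ) : csize n = 2 * n + 1 := by
  induction n with
  | zero => rfl
  | succ n ih =>
    have : csize (n + 1) = 1 + csize n + 1 := rfl
    omega

theorem csize_append (l l' : List α) : csize (l ++ l') + 1 = csize l + csize l' := by
  induction l with
  | nil => simp [csize_nil]; omega
  | cons a l ih => simp only [List.cons_append, csize_cons]; omega

theorem csize_lt_of_mem {a : α} {l : List α} (h : a ∈ l) : csize a < csize l := by
  induction l with
  | nil => simp at h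
  | cons b l ih =>
    rw [csize_cons]
    rcases List.mem_cons.1 h with rfl | h
    · omega
    · have := ih h
      omega

theorem csize_le_of_prefix {l l' : List α} (h : l' <+: l) : csize l' ≤ csize l := by
  obtain ⟨t, rfl⟩ := h
  have := csize_append l' t
  have := csize_pos t
  omega

theorem csize_le_of_forall {l : List α} {B : ℕ} (h : ∀ a ∈ l, csize a ≤ B) :
    csize l ≤ 1 + l.length * (B + 1) := by
  induction l with
  | nil => simp [csize_nil]
  | cons a l ih =>
    have h1 := h a (by simp)
    have h2 := ih fun b hb => h b (by simp [hb])
    simp only [csize_cons, List.length_cons, Nat.add_mul]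
    omega

theorem csize_foldl_le {β : Type} (step : σ → β → σ) (B : ℕ) (l : List β)
    (h : ∀ s, ∀ a ∈ l, csize (step s a) ≤ csize s + B) (s : σ) :
    csize (l.foldl step s) ≤ csize s + l.length * B := by
  induction l generalizing s with
  | nil => simp
  | cons a l ih =>
    have h1 := ih (fun s b hb => h s b (by simp [hb])) (step s a)
    have h2 := h s a (by simp)
    simp only [List.foldl_cons, List.length_cons, Nat.add_mul]
    omega

/-- The states of an iteration have polynomial size if each step adds at most a quantity that is
bounded independently of the state. -/
theorem bound_of_additive {l : α → List β} {init : α → σ} {step : α → σ → β → σ}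
    (hl : PolyFn l) (hi : PolyFn init)
    (hs : ∃ q : Polynomial ℕ, ∀ x s, ∀ a ∈ l x, csize (step x s a) ≤ csize s + q.eval (csize x)) :
    ∃ q : Polynomial ℕ, ∀ x l', l' <+: l x →
      csize (l'.foldl (step x) (init x)) ≤ q.eval (csize x) := by
  obtain ⟨q, hq⟩ := hs
  obtain ⟨ql, hql⟩ := hl.bound
  obtain ⟨qi, hqi⟩ := hi.bound
  refine ⟨qi + ql * q, fun x l' hl' => ?_⟩
  have h1 := csize_foldl_le (step x) _ l' (fun s a ha => hq x s a (hl'.subset ha)) (init x)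
  have h2 := hqi x
  have h3 : l'.length ≤ ql.eval (csize x) :=
    hl'.length_le.trans ((length_le_csize _).le.trans (hql x))
  have h4 := Nat.mul_le_mul_right (q.eval (csize x)) h3
  simp only [Polynomial.eval_add, Polynomial.eval_mul]
  omega

/-! #### Case distinctions -/

@[fun_prop]
theorem ite {c : α → Bool} {f g : α → β} (hc : PolyFn c) (hf : PolyFn f) (hg : PolyFn g) :
    PolyFn fun x => if c x then f x else g x := by
  refine branch (δ := Unit) (ε := Unit) (g := fun y => f y.1) hc hg (by fun_prop) fun x => ?_
  cases h : c x
  · exact .inl ⟨by simp [enc], by simp⟩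
  · exact .inr ⟨(), (), by simp [enc], by simp⟩

@[fun_prop]
theorem and {f g : α → Bool} (hf : PolyFn f) (hg : PolyFn g) : PolyFn fun x => f x && g x := by
  have : PolyFn fun x => if f x then g x else false := by fun_prop
  refine this.congr_enc fun x => ?_
  cases f x <;> rfl

theorem optionElim {c : α → Option γ} {f : α → β} {g : α × γ → β} (hc : PolyFn c) (hf : PolyFn f)
    (hg : PolyFn g) : PolyFn fun x => (c x).elim (f x) fun y => g (x, y) := by
  refine branch (δ := γ) (ε := Unit) (g := fun y => g (y.1, y.2.1)) hc hf (by fun_prop) fun x => ?_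
  cases h : c x with
  | none => exact .inl ⟨rfl, rfl⟩
  | some y => exact .inr ⟨y, (), rfl, rfl⟩

@[fun_prop]
theorem some {f : α → β} (hf : PolyFn f) : PolyFn fun x => some (f x) := by
  have : PolyFn fun x => (f x, ()) := by fun_prop
  exact this.congr_enc fun x => rfl

/-! #### Numbers -/

@[fun_prop]
theorem succ {f : α → ℕ} (hf : PolyFn f) : PolyFn fun x => f x + 1 := by
  have : PolyFn fun x => ((), f x) := by fun_prop
  exact this.congr_enc fun x => rfl

@[fun_prop]
theorem pred {f : α → ℕ} (hf : PolyFn f) : PolyFn fun x => f x - 1 := by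
  refine branch (δ := Unit) (ε := ℕ) (f := fun _ => 0) (g := fun y => y.2.2) hf
    (by fun_prop) (by fun_prop) fun x => ?_
  cases h : f x with
  | zero => exact .inl ⟨rfl, rfl⟩
  | succ n => exact .inr ⟨(), n, rfl, rfl⟩

@[fun_prop]
theorem decide_eq_zero {f : α → ℕ} (hf : PolyFn f) : PolyFn fun x => decide (f x = 0) := by
  refine branch (δ := Unit) (ε := ℕ) (f := fun _ => true) (g := fun y => false) hf
    (by fun_prop) (by fun_prop) fun x => ?_
  cases h : f x with
  | zero => exact .inl ⟨rfl, rfl⟩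
  | succ n => exact .inr ⟨(), n, rfl, rfl⟩

theorem replicate_unit {f : α → ℕ} (hf : PolyFn f) : PolyFn fun x => List.replicate (f x) () := by
  refine hf.congr_enc fun x => ?_
  induction f x with
  | zero => rfl
  | succ n ih => exact congrArg (Dat.node .leaf) ih

@[fun_prop]
theorem sub {f g : α → ℕ} (hf : PolyFn f) (hg : PolyFn g) : PolyFn fun x => f x - g x := by
  have : PolyFn fun x => (List.replicate (g x) ()).foldl (fun s _ => s - 1) (f x) := by
    refine foldl (replicate_unit hg) hf (by fun_prop)
      (bound_of_additive (replicate_unit hg) hf ⟨0, fun x s a _ => ?_⟩)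
    simp only [csize_nat]
    omega
  convert this using 2 with x
  induction g x with
  | zero => rfl
  | succ n ih => rw [List.replicate_succ', List.foldl_append, ← ih]; rfl

@[fun_prop]
theorem add {f g : α → ℕ} (hf : PolyFn f) (hg : PolyFn g) : PolyFn fun x => f x + g x := by
  have : PolyFn fun x => (List.replicate (g x) ()).foldl (fun s _ => s + 1) (f x) := by
    refine foldl (replicate_unit hg) hf (by fun_prop)
      (bound_of_additive (replicate_unit hg) hf ⟨2, fun x s a _ => ?_⟩)
    simp only [csize_nat, Polynomial.eval_ofNat]
    omega
  convert this using 2 with x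
  induction g x with
  | zero => rfl
  | succ n ih => rw [List.replicate_succ', List.foldl_append, ← ih]; rfl

@[fun_prop]
theorem mul {f g : α → ℕ} (hf : PolyFn f) (hg : PolyFn g) : PolyFn fun x => f x * g x := by
  have : PolyFn fun x => (List.replicate (g x) ()).foldl (fun s _ => s + f x) 0 := by
    obtain ⟨q, hq⟩ := hf.bound
    have h0 : PolyFn fun _ : α => 0 := by fun_prop
    refine foldl (step := fun x s _ => s + f x) (replicate_unit hg) h0 (by fun_prop)
      (bound_of_additive (replicate_unit hg) h0 ⟨q, fun x s a _ => ?_⟩)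
    have := hq x
    simp only [csize_nat] at *
    omega
  convert this using 2 with x
  induction g x with
  | zero => rfl
  | succ n ih => rw [List.replicate_succ', List.foldl_append, ← ih]; rfl

@[fun_prop]
theorem decide_eq {f g : α → ℕ} (hf : PolyFn f) (hg : PolyFn g) :
    PolyFn fun x => decide (f x = g x) := by
  have : PolyFn fun x => decide (f x - g x = 0) && decide (g x - f x = 0) := by fun_prop
  refine this.congr_enc fun x => congrArg enc ?_
  rw [Bool.eq_iff_iff]
  simp
  omega

/-! #### Lists -/

@[fun_prop]
theorem cons {f : α → β} {g : α → List β} (hf : PolyFn f) (hg : PolyFn g) :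
    PolyFn fun x => f x :: g x :=
  (prodMk hf hg).congr_enc fun _ => rfl

@[fun_prop]
theorem reverse {f : α → List β} (hf : PolyFn f) : PolyFn fun x => (f x).reverse := by
  have : PolyFn fun x => (f x).foldl (fun s a => a :: s) [] := by
    obtain ⟨q, hq⟩ := hf.bound
    refine foldl hf (by fun_prop) (by fun_prop)
      (bound_of_additive hf (by fun_prop) ⟨q + 1, fun x s a ha => ?_⟩)
    have := hq x
    have := csize_lt_of_mem ha
    simp only [csize_cons, Polynomial.eval_add, Polynomial.eval_one] at *
    omega
  convert this using 2 with x
  simp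

@[fun_prop]
theorem append {f g : α → List β} (hf : PolyFn f) (hg : PolyFn g) :
    PolyFn fun x => f x ++ g x := by
  have : PolyFn fun x => (f x).reverse.foldl (fun s a => a :: s) (g x) := by
    obtain ⟨q, hq⟩ := hf.bound
    refine foldl (by fun_prop) hg (by fun_prop)
      (bound_of_additive (by fun_prop) hg ⟨q + 1, fun x s a ha => ?_⟩)
    have := hq x
    have := csize_lt_of_mem (List.mem_reverse.1 ha)
    simp only [csize_cons, Polynomial.eval_add, Polynomial.eval_one] at *
    omega
  convert this using 2 with x
  simp

/-- Iteration along a list with an output in each step. -/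
theorem foldlOut {l : α → List β} {init : α → σ} {o : α → List γ} {step : α → σ → β → σ}
    {out : α → σ → β → List γ} (hl : PolyFn l) (hi : PolyFn init) (ho : PolyFn o)
    (hs : PolyFn fun x : (α × σ) × β => step x.1.1 x.1.2 x.2)
    (hout : PolyFn fun x : (α × σ) × β => out x.1.1 x.1.2 x.2)
    (hq : ∃ q : Polynomial ℕ, ∀ x l', l' <+: l x →
      csize (l'.foldl (step x) (init x)) ≤ q.eval (csize x)) :
    PolyFn fun x => (l x).foldl (fun s a => (step x s.1 a, s.2 ++ out x s.1 a)) (init x, o x) := by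
  have hs' : PolyFn fun x : (α × σ × List γ) × β => step x.1.1 x.1.2.1 x.2 :=
    hs.comp (f := fun x : (α × σ × List γ) × β => ((x.1.1, x.1.2.1), x.2)) (by fun_prop)
  have hout' : PolyFn fun x : (α × σ × List γ) × β => out x.1.1 x.1.2.1 x.2 :=
    hout.comp (f := fun x : (α × σ × List γ) × β => ((x.1.1, x.1.2.1), x.2)) (by fun_prop)
  refine foldl (step := fun x s a => (step x s.1 a, s.2 ++ out x s.1 a)) hl (prodMk hi ho)
    (prodMk hs' (append (by fun_prop) hout')) ?_
  obtain ⟨q, hq⟩ := hq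
  obtain ⟨ql, hql⟩ := hl.bound
  obtain ⟨qo, hqo⟩ := ho.bound
  obtain ⟨qt, hqt⟩ := hout.bound
  have fst_eq (x : α) (l' : List β) (s) :
      (l'.foldl (fun s a => (step x s.1 a, s.2 ++ out x s.1 a)) s).1 = l'.foldl (step x) s.1 := by
    induction l' generalizing s with
    | nil => rfl
    | cons a l' ih => simp [ih]
  refine ⟨q + (qo + ql * qt.comp (.X + q + ql + 2)) + 1, fun x l' hl' => ?_⟩
  have key (l') (hl' : l' <+: l x) :
      csize (l'.foldl (fun s a => (step x s.1 a, s.2 ++ out x s.1 a)) (init x, o x)).2 ≤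
        qo.eval (csize x) + l'.length * (qt.comp (.X + q + ql + 2)).eval (csize x) := by
    induction l' using List.reverseRecOn with
    | nil => simpa using hqo x
    | append_singleton l' a ih =>
      have hp : l' <+: l x := (List.prefix_append _ _).trans hl'
      have h1 := ih hp
      have h2 := hqt ((x, l'.foldl (step x) (init x)), a)
      have h3 := hq x l' hp
      have h4 : csize a ≤ ql.eval (csize x) :=
        (csize_lt_of_mem (hl'.subset (by simp))).le.trans (hql x)
      have h5 := h2.trans (qt.eval_le_eval_of_le
        (b := (Polynomial.X + q + ql + 2).eval (csize x)) (by
          simp only [csize_prod, Polynomial.eval_add, Polynomial.eval_X, Polynomial.eval_ofNat]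
          omega))
      have h6 := csize_append
        (l'.foldl (fun s a => (step x s.1 a, s.2 ++ out x s.1 a)) (init x, o x)).2
        (out x (l'.foldl (step x) (init x)) a)
      simp only [List.foldl_append, List.foldl_cons, List.foldl_nil, fst_eq, List.length_append,
        List.length_singleton, Nat.add_mul, Nat.one_mul, Polynomial.eval_comp] at *
      omega
  have h1 := key l' hl'
  have h2 := hq x l' hl'
  have h3 : l'.length ≤ ql.eval (csize x) :=
    hl'.length_le.trans ((length_le_csize _).le.trans (hql x))
  have h4 := Nat.mul_le_mul_right ((qt.comp (.X + q + ql + 2)).eval (csize x)) h3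
  rw [← Prod.eta (List.foldl _ _ _), csize_prod, fst_eq]
  simp only [Polynomial.eval_add, Polynomial.eval_mul, Polynomial.eval_one]
  omega

theorem flatMap {l : α → List β} {f : α → β → List γ} (hl : PolyFn l)
    (hf : PolyFn fun x : α × β => f x.1 x.2) : PolyFn fun x => (l x).flatMap (f x) := by
  have h := foldlOut (init := fun _ : α => ()) (o := fun _ => []) (step := fun _ _ _ => ())
    (out := fun x _ a => f x a) hl (by fun_prop) (by fun_prop) (by fun_prop)
    (hf.comp (f := fun x : (α × Unit) × β => (x.1.1, x.2)) (by fun_prop))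
    ⟨1, fun x l' _ => by simp [csize, enc, Dat.size]⟩
  refine h.snd.congr_enc fun x => congrArg enc ?_
  have key (l : List β) (o : List γ) :
      (l.foldl (fun s a => ((), s.2 ++ f x a)) ((), o)).2 = o ++ l.flatMap (f x) := by
    induction l generalizing o with
    | nil => simp
    | cons a l ih => simp [ih]
  simpa using (key (l x) []).symm

theorem map {l : α → List β} {f : α → β → γ} (hl : PolyFn l)
    (hf : PolyFn fun x : α × β => f x.1 x.2) : PolyFn fun x => (l x).map (f x) := by
  have := flatMap (f := fun x a => [f x a]) hl (by fun_prop)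
  simpa only [← List.map_eq_flatMap] using this

@[fun_prop]
theorem range {f : α → ℕ} (hf : PolyFn f) : PolyFn fun x => List.range (f x) := by
  have h := foldlOut (l := fun x => List.replicate (f x) ()) (init := fun _ : α => 0)
    (o := fun _ => []) (step := fun _ s _ => s + 1) (out := fun _ s _ => [s])
    (replicate_unit hf) (by fun_prop) (by fun_prop) (by fun_prop) (by fun_prop)
    (bound_of_additive (replicate_unit hf) (by fun_prop) ⟨2, fun x s a _ => by
      simp only [csize_nat, Polynomial.eval_ofNat]
      omega⟩)
  refine h.snd.congr_enc fun x => congrArg enc ?_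
  have key (n : ℕ) : (List.replicate n ()).foldl (fun s (_ : Unit) => (s.1 + 1, s.2 ++ [s.1]))
      ((0 : ℕ), ([] : List ℕ)) = (n, List.range n) := by
    induction n with
    | zero => rfl
    | succ n ih => rw [List.replicate_succ', List.foldl_append, ih]; simp [List.range_succ]
  exact (congrArg Prod.snd (key _)).symm

end PolyFn

/-! ### The construction of the grammar -/

namespace Construction

/-- The data of an action: source, popped symbol, whether a letter is read, target, pushed word. -/
abbrev Action (Q G : Type) : Type := Q × G × Bool × Q × List G

/-- The data of a rule over a one-letter alphabet: a variable and a word, in which `none` stands for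
the letter. -/
abbrev Rule (V : Type) : Type := V × List (Option V)

variable {Q G V : Type} [DecidableEq Q] [DecidableEq G]

/-- The value at `(q, X)` of the partial function that is given by the list `E` of its graph. -/
def lookup (E : List (Q × G × Q)) (q : Q) (X : G) : Option Q :=
  E.foldl (fun r e => if decide (e.1 = q) && decide (e.2.1 = X) then some e.2.2 else r) none

/-- One step of `chain`. -/
def chainStep (E : List (Q × G × Q)) (c : Option Q) (Y : G) : Option Q :=
  c.elim none fun q => lookup E q Y

/-- The state that is reached from the state `c` after the word `β` has been popped from the stack,
if `E` tells the state that is reached when a single symbol has been popped. -/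
def chain (E : List (Q × G × Q)) (c : Option Q) (β : List G) : Option Q :=
  β.foldl (chainStep E) c

/-- The pops that the actions in `A` make possible if those in `E` are. -/
def improve (A : List (Action Q G)) (E : List (Q × G × Q)) : List (Q × G × Q) :=
  A.flatMap fun a => (chain E (some a.2.2.2.1) a.2.2.2.2).elim [] fun r => [(a.1, a.2.1, r)]

/-- The exit function: the triples `(q, X, r)` such that `X` is popped in state `q` by a computation
that ends in state `r`, obtained by iterating `improve`. -/
def exits (A : List (Action Q G)) : List (Q × G × Q) :=
  A.foldl (fun E _ => improve A E) []

/-- The variable to be appended by one step of `path`. -/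
def pathOut (vp : Q → G → V) (c : Option Q) (Y : G) : List (Option V) :=
  c.elim [] fun q => [some (vp q Y)]

/-- One step of `path`. -/
def pathStep (E : List (Q × G × Q)) (vp : Q → G → V) (s : Option Q × List (Option V)) (Y : G) :
    Option Q × List (Option V) :=
  (chainStep E s.1 Y, s.2 ++ pathOut vp s.1 Y)

/-- The state that is reached when `β` is popped, as given by `chain`, with the word of the variables
`vp q Y` for the successive states `q` and symbols `Y` appended to the second component. -/
def path (E : List (Q × G × Q)) (vp : Q → G → V) (s : Option Q × List (Option V)) (β : List G) :
    Option Q × List (Option V) :=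
  β.foldl (pathStep E vp) s

/-- The rule to be output by one step of `accRules`. -/
def accOut (va : Q → G → V) (v : V) (s : Option Q × List (Option V)) (Y : G) : List (Rule V) :=
  s.1.elim [] fun q => [(v, s.2 ++ [some (va q Y)])]

/-- The rules for computations that do not pop all of `β`: some prefix of `β` is popped and a
computation above the rest starts with the next symbol. -/
def accRules (E : List (Q × G × Q)) (vp va : Q → G → V) (v : V) (s : Option Q × List (Option V))
    (β : List G) : List (Rule V) :=
  (β.foldl (fun s Y => (pathStep E vp s.1 Y, s.2 ++ accOut va v s.1 Y)) (s, [])).2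

/-- The rule for computations that pop a word, if there are any. -/
def popRule (v : V) (s : Option Q × List (Option V)) : List (Rule V) :=
  s.1.elim [] fun _ => [(v, s.2)]

/-- State and word after the action `a`. -/
def afterAction (a : Action Q G) : Option Q × List (Option V) :=
  (some a.2.2.2.1, if a.2.2.1 then [none] else [])

/-- The rules that stem from the action `a`. -/
def actionRules (E : List (Q × G × Q)) (vp va : Q → G → V) (a : Action Q G) : List (Rule V) :=
  popRule (vp a.1 a.2.1) (path E vp (afterAction a) a.2.2.2.2) ++
    accRules E vp va (va a.1 a.2.1) (afterAction a) a.2.2.2.2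

/-- The rules of the start variable `vs`. -/
def startRules (E : List (Q × G × Q)) (vp va : Q → G → V) (vs : V) (start : Q) (bottom : G)
    (F : List Q) : List (Rule V) :=
  (vs, [some (va start bottom)]) :: (lookup E start bottom).elim [] fun r => F.flatMap fun q =>
     if decide (q = r) then [(vs, [some (vp start bottom)])] else []

/-- The rules by which a computation ends in a final state. -/
def finalRules (va : Q → G → V) (F : List Q) (Γ : List G) : List (Rule V) :=
  F.flatMap fun q => Γ.map fun X => (va q X, [])

/-- All rules of the grammar. -/
def rules (vp va : Q → G → V) (vs : V) (start : Q) (bottom : G) (F : List Q)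
    (A : List (Action Q G)) (Γ : List G) : List (Rule V) :=
  let E := exits A
  startRules E vp va vs start bottom F ++ (finalRules va F Γ ++ A.flatMap (actionRules E vp va))

/-! ### The construction takes polynomial time -/

section PolyFn

variable {α β : Type} [Enc α] [Enc β]

theorem lookup_mem {E : List (Q × G × Q)} {q : Q} {X : G} {r : Q} (h : lookup E q X = some r) :
    (q, X, r) ∈ E := by
  suffices H : ∀ (E' : List (Q × G × Q)) (c : Option Q), (∀ r, c = some r → (q, X, r) ∈ E) →
      E' ⊆ E → ∀ r, E'.foldl (fun r e => if decide (e.1 = q) && decide (e.2.1 = X) then some e.2.2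
        else r) c = some r → (q, X, r) ∈ E from H E none (by simp) (List.Subset.refl _) r h
  intro E'
  induction E' with
  | nil => intro c hc _ r hr; exact hc r hr
  | cons e E' ih =>
    intro c hc hE r hr
    refine ih _ (fun r' hr' => ?_) (fun x hx => hE (by simp [hx])) r hr
    beta_reduce at hr'
    split_ifs at hr' with hcond
    · simp only [Bool.and_eq_true, decide_eq_true_eq] at hcond
      obtain ⟨rfl, rfl⟩ := hcond
      simp only [Option.some.injEq] at hr'
      subst hr'
      exact hE (by simp)
    · exact hc _ hr'

theorem csize_lookup_le (E : List (ℕ × ℕ × ℕ)) (q X : ℕ) : csize (lookup E q X) ≤ csize E + 2 := by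
  cases h : lookup E q X with
  | none => rw [PolyFn.csize_none]; omega
  | some r =>
    have := PolyFn.csize_lt_of_mem (lookup_mem h)
    simp only [PolyFn.csize_some, PolyFn.csize_prod] at *
    omega

theorem csize_chainStep_le (E : List (ℕ × ℕ × ℕ)) (c : Option ℕ) (X : ℕ) :
    csize (chainStep E c X) ≤ csize E + 2 := by
  cases c with
  | none => simp [chainStep, PolyFn.csize_none]
  | some q => exact csize_lookup_le E q X

theorem polyFn_lookup {E : α → List (ℕ × ℕ × ℕ)} {q X : α → ℕ} (hE : PolyFn E) (hq : PolyFn q)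
    (hX : PolyFn X) : PolyFn fun x => lookup (E x) (q x) (X x) := by
  obtain ⟨qE, hqE⟩ := hE.bound
  refine PolyFn.foldl (step := fun x r e => if decide (e.1 = q x) && decide (e.2.1 = X x) then
    some e.2.2 else r) hE (by fun_prop) (by fun_prop)
    (PolyFn.bound_of_additive hE (by fun_prop) ⟨qE + 2, fun x s a ha => ?_⟩)
  have h1 := PolyFn.csize_lt_of_mem ha
  have h2 := hqE x
  simp only [Polynomial.eval_add, Polynomial.eval_ofNat]
  split_ifs
  · obtain ⟨a1, a2, a3⟩ := a
    simp only [PolyFn.csize_some, PolyFn.csize_prod] at *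
    omega
  · omega

theorem polyFn_chainStep {E : α → List (ℕ × ℕ × ℕ)} {c : α → Option ℕ} {X : α → ℕ}
    (hE : PolyFn E) (hc : PolyFn c) (hX : PolyFn X) :
    PolyFn fun x => chainStep (E x) (c x) (X x) :=
  PolyFn.optionElim (f := fun _ => none) (g := fun y => lookup (E y.1) y.2 (X y.1)) hc (by fun_prop)
    (polyFn_lookup (by fun_prop) (by fun_prop) (by fun_prop))

theorem bound_chain {E : α → List (ℕ × ℕ × ℕ)} {c : α → Option ℕ} {w : α → List ℕ}
    (hE : PolyFn E) (hc : PolyFn c) (hw : PolyFn w) : ∃ q : Polynomial ℕ, ∀ x l', l' <+: w x →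
      csize (l'.foldl (chainStep (E x)) (c x)) ≤ q.eval (csize x) := by
  obtain ⟨qE, hqE⟩ := hE.bound
  refine PolyFn.bound_of_additive hw hc ⟨qE + 2, fun x s a ha => ?_⟩
  have h1 := hqE x
  have h2 := csize_chainStep_le (E x) s a
  simp only [Polynomial.eval_add, Polynomial.eval_ofNat]
  omega

theorem polyFn_chain {E : α → List (ℕ × ℕ × ℕ)} {c : α → Option ℕ} {w : α → List ℕ}
    (hE : PolyFn E) (hc : PolyFn c) (hw : PolyFn w) : PolyFn fun x => chain (E x) (c x) (w x) :=
  PolyFn.foldl (step := fun x => chainStep (E x)) hw hc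
    (polyFn_chainStep (by fun_prop) (by fun_prop) (by fun_prop)) (bound_chain hE hc hw)

theorem polyFn_improve {A : α → List (Action ℕ ℕ)} {E : α → List (ℕ × ℕ × ℕ)}
    (hA : PolyFn A) (hE : PolyFn E) : PolyFn fun x => improve (A x) (E x) := by
  refine PolyFn.flatMap (f := fun x a =>
    (chain (E x) (some a.2.2.2.1) a.2.2.2.2).elim [] fun r => [(a.1, a.2.1, r)]) hA ?_
  exact PolyFn.optionElim (f := fun _ => []) (g := fun y => [(y.1.2.1, y.1.2.2.1, y.2)])
    (polyFn_chain (E := fun x : α × Action ℕ ℕ => E x.1) (c := fun x => some x.2.2.2.2.1)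
      (w := fun x => x.2.2.2.2.2) (by fun_prop) (by fun_prop) (by fun_prop))
    (by fun_prop) (by fun_prop)

/-- If the values of a partial function are targets of actions, then so are the states reached by means
of it. -/
theorem chain_mem {A : List (Action Q G)} {E : List (Q × G × Q)}
    (hE : ∀ e ∈ E, ∃ a ∈ A, e.2.2 = a.2.2.2.1) {c : Option Q} (hc : ∀ q ∈ c, ∃ a ∈ A, q = a.2.2.2.1)
    (w : List G) : ∀ q ∈ chain E c w, ∃ a ∈ A, q = a.2.2.2.1 := by
  induction w generalizing c with
  | nil => exact hc
  | cons X w ih =>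
    refine ih fun q hq => ?_
    cases c with
    | none => simp [chainStep] at hq
    | some c => exact hE _ (lookup_mem hq)

/-- Every entry of an improved table belongs to an action, and its last component is the target of an
action. This bounds the size of the tables that occur in the computation of `exits`. -/
theorem improve_mem {A : List (Action Q G)} {E : List (Q × G × Q)}
    (hE : ∀ e ∈ E, ∃ a ∈ A, e.2.2 = a.2.2.2.1) {e : Q × G × Q} (he : e ∈ improve A E) :
    ∃ a ∈ A, e.1 = a.1 ∧ e.2.1 = a.2.1 ∧ ∃ a' ∈ A, e.2.2 = a'.2.2.2.1 := by
  simp only [improve, List.mem_flatMap] at he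
  obtain ⟨a, ha, he⟩ := he
  cases hr : chain E (some a.2.2.2.1) a.2.2.2.2 with
  | none => simp [hr] at he
  | some r =>
    simp only [hr, Option.elim_some, List.mem_singleton] at he
    subst he
    refine ⟨a, ha, rfl, rfl, chain_mem hE (fun q hq => ⟨a, ha, ?_⟩) _ r hr⟩
    simpa using hq.symm

theorem length_improve_le (A : List (Action Q G)) (E : List (Q × G × Q)) :
    (improve A E).length ≤ A.length := by
  unfold improve
  induction A with
  | nil => simp
  | cons a A ih =>
    simp only [List.flatMap_cons, List.length_append, List.length_cons]
    cases chain E (some a.2.2.2.1) a.2.2.2.2 <;>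
      simp only [Option.elim_none, Option.elim_some, List.length_nil, List.length_singleton] <;> omega

theorem polyFn_exits {A : α → List (Action ℕ ℕ)} (hA : PolyFn A) :
    PolyFn fun x => exits (A x) := by
  obtain ⟨q, hq⟩ := hA.bound
  refine PolyFn.foldl (step := fun x E _ => improve (A x) E) hA (by fun_prop)
    (polyFn_improve (by fun_prop) (by fun_prop)) ⟨1 + q * (3 * q + 2 + 1), fun x l' hl' => ?_⟩
  have key (l : List (Action ℕ ℕ)) : ∀ E : List (ℕ × ℕ × ℕ), (∀ e ∈ E, ∃ a ∈ A x, e.1 = a.1 ∧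
      e.2.1 = a.2.1 ∧ ∃ a' ∈ A x, e.2.2 = a'.2.2.2.1) → E.length ≤ (A x).length →
      (∀ e ∈ l.foldl (fun E _ => improve (A x) E) E, ∃ a ∈ A x, e.1 = a.1 ∧
      e.2.1 = a.2.1 ∧ ∃ a' ∈ A x, e.2.2 = a'.2.2.2.1) ∧
      (l.foldl (fun E _ => improve (A x) E) E).length ≤ (A x).length := by
    induction l with
    | nil => intro E h1 h2; exact ⟨h1, h2⟩
    | cons a l ih =>
      intro E h1 h2
      exact ih _ (fun e he => improve_mem (fun e he => (h1 e he).elim fun _ h => h.2.2.2) he)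
        (length_improve_le _ _)
  obtain ⟨h1, h2⟩ := key l' [] (by simp) (by simp)
  have hsz : ∀ e ∈ l'.foldl (fun E _ => improve (A x) E) [], csize e ≤ 3 * q.eval (csize x) + 2 := by
    intro e he
    obtain ⟨a, ha, e1, e2, a', ha', e3⟩ := h1 e he
    have g1 := PolyFn.csize_lt_of_mem ha
    have g2 := PolyFn.csize_lt_of_mem ha'
    have g3 := hq x
    obtain ⟨u, v, w⟩ := e
    obtain ⟨a1, a2, a3, a4, a5⟩ := a
    obtain ⟨b1, b2, b3, b4, b5⟩ := a'
    simp only at e1 e2 e3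
    subst e1 e2 e3
    simp only [PolyFn.csize_prod] at *
    omega
  refine (PolyFn.csize_le_of_forall hsz).trans ?_
  have h3 : (A x).length ≤ q.eval (csize x) := (PolyFn.length_le_csize _).le.trans (hq x)
  have h4 := Nat.mul_le_mul_right (3 * q.eval (csize x) + 2 + 1) (h2.trans h3)
  simp only [Polynomial.eval_add, Polynomial.eval_mul, Polynomial.eval_ofNat, Polynomial.eval_one]
  omega

variable {vp va : α → ℕ → ℕ → ℕ}

theorem polyFn_pathOut (hvp : PolyFn fun x : α × ℕ × ℕ => vp x.1 x.2.1 x.2.2) {c : α → Option ℕ}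
    {Y : α → ℕ} (hc : PolyFn c) (hY : PolyFn Y) : PolyFn fun x => pathOut (vp x) (c x) (Y x) :=
  PolyFn.optionElim (f := fun _ => []) (g := fun y => [some (vp y.1 y.2 (Y y.1))]) hc (by fun_prop)
    (PolyFn.cons (PolyFn.some (hvp.comp
      (f := fun y : α × ℕ => (y.1, y.2, Y y.1)) (by fun_prop))) (by fun_prop))

theorem polyFn_path (hvp : PolyFn fun x : α × ℕ × ℕ => vp x.1 x.2.1 x.2.2)
    {E : α → List (ℕ × ℕ × ℕ)} {s : α → Option ℕ × List (Option ℕ)} {w : α → List ℕ}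
    (hE : PolyFn E) (hs : PolyFn s) (hw : PolyFn w) :
    PolyFn fun x => path (E x) (vp x) (s x) (w x) :=
  PolyFn.foldlOut (init := fun x => (s x).1) (o := fun x => (s x).2)
    (step := fun x => chainStep (E x)) (out := fun x c Y => pathOut (vp x) c Y) hw (by fun_prop)
    (by fun_prop) (polyFn_chainStep (by fun_prop) (by fun_prop) (by fun_prop))
    (polyFn_pathOut (α := (α × Option ℕ) × ℕ) (vp := fun y => vp y.1.1)
      (hvp.comp (f := fun y : ((α × Option ℕ) × ℕ) × ℕ × ℕ => (y.1.1.1, y.2)) (by fun_prop))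
      (by fun_prop) (by fun_prop))
    (bound_chain hE (by fun_prop) hw)

theorem polyFn_pathStep (hvp : PolyFn fun x : α × ℕ × ℕ => vp x.1 x.2.1 x.2.2)
    {E : α → List (ℕ × ℕ × ℕ)} {s : α → Option ℕ × List (Option ℕ)} {Y : α → ℕ}
    (hE : PolyFn E) (hs : PolyFn s) (hY : PolyFn Y) :
    PolyFn fun x => pathStep (E x) (vp x) (s x) (Y x) :=
  PolyFn.prodMk (polyFn_chainStep hE (by fun_prop) hY)
    (PolyFn.append (by fun_prop) (polyFn_pathOut hvp (by fun_prop) hY))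

theorem polyFn_accOut (hva : PolyFn fun x : α × ℕ × ℕ => va x.1 x.2.1 x.2.2) {v : α → ℕ}
    {s : α → Option ℕ × List (Option ℕ)} {Y : α → ℕ} (hv : PolyFn v) (hs : PolyFn s)
    (hY : PolyFn Y) : PolyFn fun x => accOut (va x) (v x) (s x) (Y x) :=
  PolyFn.optionElim (c := fun x => (s x).1) (f := fun _ => [])
    (g := fun y => [(v y.1, (s y.1).2 ++ [some (va y.1 y.2 (Y y.1))])]) (by fun_prop) (by fun_prop)
    (PolyFn.cons (PolyFn.prodMk (by fun_prop) (PolyFn.append (by fun_prop)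
      (PolyFn.cons (PolyFn.some (hva.comp
      (f := fun y : α × ℕ => (y.1, y.2, Y y.1)) (by fun_prop))) (by fun_prop)))) (by fun_prop))

theorem polyFn_accRules (hvp : PolyFn fun x : α × ℕ × ℕ => vp x.1 x.2.1 x.2.2)
    (hva : PolyFn fun x : α × ℕ × ℕ => va x.1 x.2.1 x.2.2)
    {E : α → List (ℕ × ℕ × ℕ)} {v : α → ℕ} {s : α → Option ℕ × List (Option ℕ)} {w : α → List ℕ}
    (hE : PolyFn E) (hv : PolyFn v) (hs : PolyFn s) (hw : PolyFn w) :
    PolyFn fun x => accRules (E x) (vp x) (va x) (v x) (s x) (w x) := by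
  refine PolyFn.snd (PolyFn.foldlOut (init := s) (o := fun x => [])
    (step := fun x => pathStep (E x) (vp x)) (out := fun x c Y => accOut (va x) (v x) c Y) hw hs
    (by fun_prop)
    (polyFn_pathStep (α := (α × Option ℕ × List (Option ℕ)) × ℕ) (vp := fun y => vp y.1.1)
      (hvp.comp (f := fun y : ((α × Option ℕ × List (Option ℕ)) × ℕ) × ℕ × ℕ => (y.1.1.1, y.2))
        (by fun_prop)) (by fun_prop) (by fun_prop) (by fun_prop))
    (polyFn_accOut (α := (α × Option ℕ × List (Option ℕ)) × ℕ) (va := fun y => va y.1.1)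
      (hva.comp (f := fun y : ((α × Option ℕ × List (Option ℕ)) × ℕ) × ℕ × ℕ => (y.1.1.1, y.2))
        (by fun_prop)) (by fun_prop) (by fun_prop) (by fun_prop)) ?_)
  -- The states are values of the function `path`, applied to prefixes of the given word.
  have h := polyFn_path (α := α × List ℕ) (vp := fun y => vp y.1)
    (hvp.comp (f := fun y : (α × List ℕ) × ℕ × ℕ => (y.1.1, y.2)) (by fun_prop))
    (E := fun y => E y.1) (s := fun y => s y.1) (w := fun y => y.2)
    (by fun_prop) (by fun_prop) (by fun_prop)
  obtain ⟨q, hq⟩ := h.bound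
  obtain ⟨qw, hqw⟩ := hw.bound
  refine ⟨q.comp (.X + qw + 1), fun x l' hl' => (hq (x, l')).trans ?_⟩
  rw [Polynomial.eval_comp]
  refine q.eval_le_eval_of_le ?_
  have h1 := (PolyFn.csize_le_of_prefix hl').trans (hqw x)
  simp only [PolyFn.csize_prod, Polynomial.eval_add, Polynomial.eval_X, Polynomial.eval_one]
  omega

theorem polyFn_actionRules (hvp : PolyFn fun x : α × ℕ × ℕ => vp x.1 x.2.1 x.2.2)
    (hva : PolyFn fun x : α × ℕ × ℕ => va x.1 x.2.1 x.2.2)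
    {E : α → List (ℕ × ℕ × ℕ)} {a : α → Action ℕ ℕ} (hE : PolyFn E) (ha : PolyFn a) :
    PolyFn fun x => actionRules (E x) (vp x) (va x) (a x) := by
  have hs : PolyFn fun x => (afterAction (V := ℕ) (a x)) := by
    unfold afterAction
    fun_prop
  have h1 : PolyFn fun x => vp x (a x).1 (a x).2.1 :=
    hvp.comp (f := fun x => (x, (a x).1, (a x).2.1)) (by fun_prop)
  have h2 : PolyFn fun x => va x (a x).1 (a x).2.1 :=
    hva.comp (f := fun x => (x, (a x).1, (a x).2.1)) (by fun_prop)
  have h3 := polyFn_path hvp hE hs (w := fun x => (a x).2.2.2.2) (by fun_prop)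
  exact PolyFn.append
    (PolyFn.optionElim (c := fun x => (path (E x) (vp x) (afterAction (a x)) (a x).2.2.2.2).1)
      (f := fun _ => []) (g := fun y => [(vp y.1 (a y.1).1 (a y.1).2.1,
        (path (E y.1) (vp y.1) (afterAction (a y.1)) (a y.1).2.2.2.2).2)]) h3.fst (by fun_prop)
      (PolyFn.cons (PolyFn.prodMk (h1.comp (f := Prod.fst) (by fun_prop))
        (h3.snd.comp (f := Prod.fst) (by fun_prop))) (by fun_prop)))
    (polyFn_accRules hvp hva hE h2 hs (by fun_prop))

theorem polyFn_rules (hvp : PolyFn fun x : α × ℕ × ℕ => vp x.1 x.2.1 x.2.2)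
    (hva : PolyFn fun x : α × ℕ × ℕ => va x.1 x.2.1 x.2.2) {vs start bottom : α → ℕ}
    {F Γ : α → List ℕ} {A : α → List (Action ℕ ℕ)} (hvs : PolyFn vs) (hstart : PolyFn start)
    (hbottom : PolyFn bottom) (hF : PolyFn F) (hA : PolyFn A) (hΓ : PolyFn Γ) :
    PolyFn fun x => rules (vp x) (va x) (vs x) (start x) (bottom x) (F x) (A x) (Γ x) := by
  have hE := polyFn_exits hA
  have h1 : PolyFn fun x => vp x (start x) (bottom x) :=
    hvp.comp (f := fun x => (x, start x, bottom x)) (by fun_prop)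
  have h2 : PolyFn fun x => va x (start x) (bottom x) :=
    hva.comp (f := fun x => (x, start x, bottom x)) (by fun_prop)
  refine PolyFn.append (PolyFn.cons (by fun_prop) ?_) (PolyFn.append ?_ ?_)
  · refine PolyFn.optionElim (c := fun x => lookup (exits (A x)) (start x) (bottom x))
      (f := fun _ => []) (g := fun y => (F y.1).flatMap fun q =>
        if decide (q = y.2) then [(vs y.1, [some (vp y.1 (start y.1) (bottom y.1))])] else [])
      (polyFn_lookup hE hstart hbottom) (by fun_prop) ?_
    have h3 : PolyFn fun x : (α × ℕ) × ℕ => vp x.1.1 (start x.1.1) (bottom x.1.1) :=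
      h1.comp (f := fun x : (α × ℕ) × ℕ => x.1.1) (by fun_prop)
    exact PolyFn.flatMap (f := fun (y : α × ℕ) q =>
        if decide (q = y.2) then [(vs y.1, [some (vp y.1 (start y.1) (bottom y.1))])] else [])
      (by fun_prop) (PolyFn.ite (by fun_prop)
        (PolyFn.cons (PolyFn.prodMk (by fun_prop) (PolyFn.cons (PolyFn.some h3) (by fun_prop)))
          (by fun_prop)) (by fun_prop))
  · refine PolyFn.flatMap (f := fun x q => (Γ x).map fun X => (va x q X, [])) hF ?_
    refine PolyFn.map (f := fun (y : α × ℕ) X => (va y.1 y.2 X, ([] : List (Option ℕ))))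
      (by fun_prop) (PolyFn.prodMk ?_ (by fun_prop))
    exact hva.comp (f := fun y : (α × ℕ) × ℕ => (y.1.1, y.1.2, y.2)) (by fun_prop)
  · refine PolyFn.flatMap (f := fun x a => actionRules (exits (A x)) (vp x) (va x) a) hA ?_
    exact polyFn_actionRules (α := α × Action ℕ ℕ) (vp := fun y => vp y.1) (va := fun y => va y.1)
      (hvp.comp (f := fun y : (α × Action ℕ ℕ) × ℕ × ℕ => (y.1.1, y.2)) (by fun_prop))
      (hva.comp (f := fun y : (α × Action ℕ ℕ) × ℕ × ℕ => (y.1.1, y.2)) (by fun_prop))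
      (hE.comp (f := Prod.fst) (by fun_prop)) (by fun_prop)

end PolyFn

end Construction

/-! ### Reading the input and writing the output -/

theorem csize_tok_le (t : Tok) : csize t ≤ 13 := by
  cases t <;> simp [csize, enc, Tok.index, encNat, Dat.size]

theorem csize_tokens_le (l : List Tok) : csize l ≤ 1 + l.length * 14 :=
  PolyFn.csize_le_of_forall fun t _ => csize_tok_le t

namespace Prog

/-- Push the letters of a word, the last one first. -/
def pushList : List Tok → Prog
  | [] => .skip
  | a :: l => .seq (pushList l) (.push .data a)

theorem runIn_pushList (i x y z : List Tok) (l r : List Tok) :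
    RunIn (pushList l) (st i r [] x y z) (l.length + 1) (st i (l ++ r) [] x y z) := by
  induction l with
  | nil => exact RunIn.skip _
  | cons a l ih => exact (RunIn.seq ih (RunIn.push (update_st_data ..))).mono (by simp)

/-- Replace the word on `io` by its representation on the working stack. -/
def input : Prog :=
  .seq (transfer .io .s1) (.seq (.push .data .nil)
    (.loop .s1 (fun _ => false) fun a => .seq (pushList (enc a).code) (.push .data .cons)))

theorem runIn_input (l : List Tok) :
    RunIn input (mem l []) (20 * l.length + 3) (mem [] (enc l).code) := by
  have h1 : RunIn (transfer .io .s1) (mem l []) (2 * l.length + 1) (st [] [] [] l.reverse [] []) := by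
    simpa [st] using runIn_transfer (k := .io) (k' := .s1) (by simp) l (mem l []) rfl
  have h2 (l : List Tok) : ∀ m : List Tok, RunIn
      (.loop .s1 (fun _ => false) fun a => .seq (pushList (enc a).code) (.push .data .cons))
      (st [] (enc m).code [] l [] []) (16 * l.length + 1) (mem [] (enc (l.reverse ++ m)).code) := by
    induction l with
    | nil => intro m; exact RunIn.loopNil rfl
    | cons a l ih =>
      intro m
      have := csize_tok_le a
      refine (RunIn.loopStep (s₂ := st [] (enc (a :: m)).code [] l [] []) rfl rfl
        (update_st_s1 ..) (RunIn.seq (runIn_pushList _ _ _ _ _ _) (RunIn.push ?_))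
        (by simpa using ih (a :: m))).mono ?_
      · simp only [update_st_data]
        congr 1
      · simp only [Dat.length_code, csize, List.length_cons] at *
        omega
  have h3 := h2 l.reverse []
  simp only [List.length_reverse, List.reverse_reverse, List.append_nil] at h3
  exact (RunIn.seq h1 (RunIn.seq (RunIn.push (update_st_data ..)) h3)).mono (by omega)

/-- The token with the given number. -/
def _root_.Tok.ofIndex : ℕ → Tok
  | 0 => .one | 1 => .sep | 2 => .cons | 3 => .nil | 4 => .letter | 5 => .eps | _ => .var

theorem _root_.Tok.ofIndex_index (t : Tok) : Tok.ofIndex t.index = t := by cases t <;> rfl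

/-- Read a number, add `i`, and push the token with the resulting number onto `s1`; `fuel` bounds the
number that can be read. -/
def readTok : (fuel i : ℕ) → Prog
  | 0, _ => .skip
  | fuel + 1, i => .pop .data fun
    | some .cons => .pop .data fun _ => readTok fuel (i + 1)
    | _ => .push .s1 (Tok.ofIndex i)

theorem runIn_readTok (x r : List Tok) (fuel n i : ℕ) (h : n < fuel) :
    RunIn (readTok fuel i) (st [] ((encNat n).code ++ r) [] x [] []) (2 * n + 2)
      (st [] r [] (Tok.ofIndex (i + n) :: x) [] []) := by
  induction fuel generalizing n i with
  | zero => omega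
  | succ fuel ih =>
    cases n with
    | zero => exact (RunIn.pop rfl (update_st_data ..) (RunIn.push (update_st_s1 ..))).mono (by simp)
    | succ n =>
      have := ih n (i + 1) (by omega)
      rw [show i + 1 + n = i + (n + 1) by omega] at this
      exact (RunIn.pop rfl (update_st_data ..) (RunIn.pop rfl (update_st_data ..) this)).mono
        (by omega)

/-- Replace the representation of a word on the working stack by the word itself on `io`. -/
def output : Prog :=
  .seq (.loop .data (fun a => match a with | .cons => false | _ => true) fun _ => readTok 7 0)
    (transfer .s1 .io)

theorem runIn_output (l : List Tok) :
    RunIn output (mem [] (enc l).code) (17 * l.length + 2) (mem l []) := by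
  have h1 (l : List Tok) : ∀ m : List Tok, RunIn
      (.loop .data (fun a => match a with | .cons => false | _ => true) fun _ => readTok 7 0)
      (st [] (enc l).code [] m [] []) (15 * l.length + 1) (st [] [] [] (l.reverse ++ m) [] []) := by
    induction l with
    | nil => intro m; exact RunIn.loopStop rfl rfl (update_st_data ..)
    | cons a l ih =>
      intro m
      have ha : a.index < 7 := by cases a <;> simp [Tok.index]
      have h2 := runIn_readTok m (enc l).code 7 a.index 0 ha
      rw [Nat.zero_add, Tok.ofIndex_index] at h2
      refine (RunIn.loopStep rfl rfl (update_st_data ..) h2 (by simpa using ih (a :: m))).mono ?_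
      simp only [List.length_cons]
      omega
  have h2 : RunIn (transfer .s1 .io) (st [] [] [] l.reverse [] []) (2 * l.length + 1) (mem l []) := by
    simpa [st] using runIn_transfer (k := .s1) (k' := .io) (by simp) l.reverse
      (st [] [] [] l.reverse [] []) rfl
  have h3 := h1 l []
  rw [List.append_nil] at h3
  exact (RunIn.seq h3 h2).mono (by omega)

end Prog

/-- A function between encoded types is computed by a machine in polynomial time if, in terms of
trees, the code of the value is computable in polynomial time from the code of the argument. -/
theorem computableInPolyTime_of_polyFn {α β : Type} [Enc α] {ea : α → List Tok}
    {eb : β → List Tok} {f : α → β} (ha : ∀ a : α, enc a = enc (ea a))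
    (hf : PolyFn fun a => eb (f a)) : Nonempty (Turing.TM2ComputableInPolyTime ea eb f) := by
  obtain ⟨p, q, hp⟩ := hf
  let Q : Polynomial ℕ := q.comp (14 * .X + 1)
  refine Prog.computableInPolyTime (.seq .input (.seq p .output)) (20 * .X + 18 * Q + 5) fun a => ?_
  have h1 : csize a ≤ 14 * (ea a).length + 1 := by
    have := csize_tokens_le (ea a)
    rw [csize, ha]
    rw [csize] at this
    omega
  have h2 : q.eval (csize a) ≤ Q.eval (ea a).length := by
    simp only [Q, Polynomial.eval_comp]
    exact q.eval_le_eval_of_le (by simpa using h1)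
  have h3 := PolyFn.length_le_csize (eb (f a))
  have h4 : csize (eb (f a)) ≤ _ := (hp a).2
  have h5 := (hp a).1 []
  rw [List.append_nil, List.append_nil, ha] at h5
  refine (RunIn.seq (Prog.runIn_input _) (RunIn.seq h5 (Prog.runIn_output _))).mono ?_
  simp only [Polynomial.eval_add, Polynomial.eval_mul, Polynomial.eval_ofNat, Polynomial.eval_X]
  omega

/-! ### Parsing automata and writing grammars -/

namespace Dat

/-- The left subtree. -/
def car : Dat → Dat
  | leaf => leaf
  | node a _ => a

/-- The right subtree. -/
def cdr : Dat → Dat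
  | leaf => leaf
  | node _ b => b

theorem size_car_add_size_cdr_le (d : Dat) : d.car.size + d.cdr.size ≤ d.size + 1 := by
  cases d with
  | leaf => simp [car, cdr, size]
  | node a b => simp only [car, cdr, size]; omega

end Dat

namespace PolyFn

variable {α β γ : Type} [Enc α] [Enc β] [Enc γ]

@[fun_prop]
theorem car {f : α → Dat} (hf : PolyFn f) : PolyFn fun x => (f x).car := by
  refine branch (δ := Dat) (ε := Dat) (f := fun _ => Dat.leaf) (g := fun y => y.2.1) hf
    (by fun_prop) (by fun_prop) fun x => ?_
  cases h : f x with
  | leaf => exact .inl ⟨rfl, rfl⟩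
  | node a b => exact .inr ⟨a, b, rfl, rfl⟩

@[fun_prop]
theorem cdr {f : α → Dat} (hf : PolyFn f) : PolyFn fun x => (f x).cdr := by
  refine branch (δ := Dat) (ε := Dat) (f := fun _ => Dat.leaf) (g := fun y => y.2.2) hf
    (by fun_prop) (by fun_prop) fun x => ?_
  cases h : f x with
  | leaf => exact .inl ⟨rfl, rfl⟩
  | node a b => exact .inr ⟨a, b, rfl, rfl⟩

@[fun_prop]
theorem node {f g : α → Dat} (hf : PolyFn f) (hg : PolyFn g) :
    PolyFn fun x => Dat.node (f x) (g x) :=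
  (prodMk hf hg).congr_enc fun _ => rfl

/-- Functions can be defined by cases on a token. -/
theorem tokCases {t : α → Tok} {h : Tok → α → β} (ht : PolyFn t) (hh : ∀ t, PolyFn (h t)) :
    PolyFn fun x => h (t x) x := by
  have hi : PolyFn fun x => (t x).index := ht.congr_enc fun _ => rfl
  have h0 := hh .one
  have h1 := hh .sep
  have h2 := hh .cons
  have h3 := hh .nil
  have h4 := hh .letter
  have h5 := hh .eps
  have h6 := hh .var
  refine (ite (decide_eq hi (const 0)) h0 (ite (decide_eq hi (const 1)) h1
    (ite (decide_eq hi (const 2)) h2 (ite (decide_eq hi (const 3)) h3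
    (ite (decide_eq hi (const 4)) h4 (ite (decide_eq hi (const 5)) h5 h6)))))).congr_enc fun x => ?_
  cases t x <;> simp [Tok.index]

@[fun_prop]
theorem encNum {f : α → ℕ} (hf : PolyFn f) : PolyFn fun x => Tok.encNum (f x) := by
  have : PolyFn fun x => (List.range (f x)).map (fun _ => Tok.one) ++ [Tok.sep] :=
    append (map (f := fun _ _ => Tok.one) (by fun_prop) (by fun_prop)) (by fun_prop)
  simpa [Tok.encNum] using this

theorem encList {l : α → List β} {e : β → List Tok} (hl : PolyFn l) (he : PolyFn e) :
    PolyFn fun x => Tok.encList e (l x) := by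
  have : PolyFn fun x => (l x).flatMap (fun b => Tok.cons :: e b) ++ [Tok.nil] :=
    append (flatMap (f := fun _ b => Tok.cons :: e b) hl
      (cons (by fun_prop) (he.comp (by fun_prop)))) (by fun_prop)
  refine this.congr_enc fun x => congrArg enc ?_
  induction l x with
  | nil => rfl
  | cons b l ih => simp [Tok.encList, ih]

end PolyFn

namespace Construction

/-- The code of a symbol of a grammar. -/
def encSym (s : Option ℕ) : List Tok := s.elim [.letter] fun i => .var :: Tok.encNum i

/-- The code of a rule of a grammar. -/
def encRule (r : Rule ℕ) : List Tok := Tok.encNum r.1 ++ Tok.encList encSym r.2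

theorem polyFn_encRule : PolyFn encRule := by
  refine PolyFn.append (by fun_prop) (PolyFn.encList (by fun_prop) ?_)
  exact PolyFn.optionElim (c := fun s => s) (f := fun _ => [Tok.letter])
    (g := fun y => Tok.var :: Tok.encNum y.2) (by fun_prop) (by fun_prop) (by fun_prop)

/-- One step of the parser, which processes the code of an automaton from right to left. Its state
consists of a stack of trees that represent the numbers and lists read so far, and of a flag that
tells whether an action is being read. The flag decides whether the token `cons` has to assemble an
action from three items on the stack or finds a single item. -/
def parseStep (t : Tok) (s : Bool × Dat) : Bool × Dat :=
  match t with
  | .one => (s.1, .node (.node .leaf s.2.car) s.2.cdr)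
  | .sep => (s.1, .node .leaf s.2)
  | .nil => (s.1, .node .leaf s.2)
  | .letter => (true, .node (.node (enc true) (.node s.2.car s.2.cdr.car)) s.2.cdr.cdr)
  | .eps => (true, .node (.node (enc false) (.node s.2.car s.2.cdr.car)) s.2.cdr.cdr)
  | .cons => if s.1 then
      (false, .node (.node (.node s.2.car (.node s.2.cdr.car s.2.cdr.cdr.car)) s.2.cdr.cdr.cdr.car)
        s.2.cdr.cdr.cdr.cdr)
      else (false, .node (.node s.2.car s.2.cdr.car) s.2.cdr.cdr)
  | .var => s

/-- The parser. -/
def parse (s : Bool × Dat) (l : List Tok) : Bool × Dat := l.foldr parseStep s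

theorem csize_parseStep_le (t : Tok) (s : Bool × Dat) : csize (parseStep t s) ≤ csize s + 20 := by
  obtain ⟨b, d⟩ := s
  have hb : csize b ≤ 3 := by cases b <;> simp [csize, enc, Dat.size]
  have hb' := csize_pos b
  have h1 := d.size_car_add_size_cdr_le
  have h2 := d.cdr.size_car_add_size_cdr_le
  have h3 := d.cdr.cdr.size_car_add_size_cdr_le
  have h4 := d.cdr.cdr.cdr.size_car_add_size_cdr_le
  have ht : csize true = 3 := rfl
  have hf : csize false = 1 := rfl
  have hd (d : Dat) : csize d = d.size := rfl
  have ht' : (enc true).size = 3 := rfl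
  have hf' : (enc false).size = 1 := rfl
  cases t
  case cons =>
    simp only [parseStep]
    split_ifs <;> simp only [PolyFn.csize_prod, hd, Dat.size] <;> omega
  all_goals
    simp only [parseStep, PolyFn.csize_prod, hd, Dat.size]
    omega

theorem polyFn_parse {α : Type} [Enc α] {l : α → List Tok} (hl : PolyFn l) :
    PolyFn fun x => parse (false, .leaf) (l x) := by
  have hstep : PolyFn fun x : (α × (Bool × Dat)) × Tok => parseStep x.2 x.1.2 := by
    refine PolyFn.tokCases (h := fun t (x : (α × (Bool × Dat)) × Tok) => parseStep t x.1.2)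
      (by fun_prop) fun t => ?_
    cases t <;> simp only [parseStep] <;> fun_prop
  have : PolyFn fun x => (l x).reverse.foldl (fun s t => parseStep t s) (false, Dat.leaf) :=
    PolyFn.foldl (step := fun _ s t => parseStep t s) (by fun_prop) (by fun_prop) hstep
      (PolyFn.bound_of_additive (by fun_prop) (by fun_prop)
        ⟨20, fun x s t _ => by simpa using csize_parseStep_le t s⟩)
  simpa [parse] using this

theorem parse_append (s : Bool × Dat) (l l' : List Tok) :
    parse s (l ++ l') = parse (parse s l') l := List.foldr_append

theorem parse_encNum (b : Bool) (d : Dat) (k : ℕ) :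
    parse (b, d) (Tok.encNum k) = (b, .node (enc k) d) := by
  induction k with
  | zero => rfl
  | succ k ih =>
    have : Tok.encNum (k + 1) = [.one] ++ Tok.encNum k := rfl
    rw [this, parse_append, ih]
    rfl

theorem parse_encList_fin {n : ℕ} (d : Dat) (l : List (Fin n)) :
    parse (false, d) (Tok.encList (fun q : Fin n => Tok.encNum q) l) =
      (false, .node (enc (l.map Fin.val)) d) := by
  induction l with
  | nil => rfl
  | cons a l ih =>
    have : Tok.encList (fun q : Fin n => Tok.encNum q) (a :: l) =
      [.cons] ++ (Tok.encNum a ++ Tok.encList (fun q : Fin n => Tok.encNum q) l) := rfl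
    rw [this, parse_append, parse_append, ih, parse_encNum]
    rfl

/-- A list of numbers that follows the input letter of an action is read with an unset flag, since
the flag is set only further to the left. -/
theorem parse_encAction {n p : ℕ} (d : Dat) (a : PDAAction Unit (Fin n) (Fin p)) :
    parse (false, d) (Tok.encAction a) = (true, .node (enc (a.source : ℕ)) (.node (enc (a.pop : ℕ))
      (.node (enc (a.input.isSome, (a.target : ℕ), a.push.map Fin.val)) d))) := by
  have hin (e : Dat) : parse (false, .node (enc (a.target : ℕ))
      (.node (enc (a.push.map Fin.val)) e)) (Tok.encInput a.input) =
        (true, .node (enc (a.input.isSome, (a.target : ℕ), a.push.map Fin.val)) e) := by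
    cases a.input <;> rfl
  simp only [Tok.encAction, parse_append, parse_encList_fin, parse_encNum, hin]

/-- The data of an action of a unary pushdown automaton. -/
def actionData {n p : ℕ} (a : PDAAction Unit (Fin n) (Fin p)) : Action (Fin n) (Fin p) :=
  (a.source, a.pop, a.input.isSome, a.target, a.push)

/-- The effect on actions of a renaming of states and stack symbols. -/
def mapAction {Q G Q' G' : Type} (f : Q → Q') (g : G → G') (a : Action Q G) : Action Q' G' :=
  (f a.1, g a.2.1, a.2.2.1, f a.2.2.2.1, a.2.2.2.2.map g)

theorem parse_encList_action {n p : ℕ} (d : Dat) (l : List (PDAAction Unit (Fin n) (Fin p))) :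
    parse (false, d) (Tok.encList Tok.encAction l) =
      (false, .node (enc (l.map fun a => mapAction Fin.val Fin.val (actionData a))) d) := by
  induction l with
  | nil => rfl
  | cons a l ih =>
    have : Tok.encList Tok.encAction (a :: l) =
      [.cons] ++ (Tok.encAction a ++ Tok.encList Tok.encAction l) := rfl
    rw [this, parse_append, parse_append, ih, parse_encAction]
    rfl

theorem parse_encPDA (P : PDA Unit) : parse (false, .leaf) (Tok.encPDA P) =
    (false, enc (P.numStates, P.numSymbols, (P.start : ℕ), (P.bottom : ℕ), P.final.map Fin.val,
      P.actions.map fun a => mapAction Fin.val Fin.val (actionData a), ())) := by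
  simp only [Tok.encPDA, parse_append, parse_encList_action, parse_encList_fin, parse_encNum]
  rfl

end Construction

/-! ### The exit function is a fixed point -/

namespace Construction

section Exits

variable {Q G V : Type} [DecidableEq Q] [DecidableEq G]

@[simp]
theorem chain_nil (E : List (Q × G × Q)) (c : Option Q) : chain E c [] = c := rfl

@[simp]
theorem chain_cons (E : List (Q × G × Q)) (c : Option Q) (Y : G) (β : List G) :
    chain E c (Y :: β) = chain E (chainStep E c Y) β := rfl

@[simp]
theorem chainStep_some (E : List (Q × G × Q)) (q : Q) (Y : G) :
    chainStep E (some q) Y = lookup E q Y := rfl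

theorem chain_append (E : List (Q × G × Q)) (c : Option Q) (β γ : List G) :
    chain E c (β ++ γ) = chain E (chain E c β) γ := List.foldl_append

@[simp]
theorem chain_none (E : List (Q × G × Q)) (β : List G) : chain E none β = none := by
  induction β with
  | nil => rfl
  | cons Y β ih => exact ih

theorem exists_lookup_of_mem {E : List (Q × G × Q)} {q : Q} {X : G} {r : Q} (h : (q, X, r) ∈ E) :
    ∃ r', lookup E q X = some r' := by
  suffices H : ∀ c : Option Q, ((q, X, r) ∈ E ∨ ∃ r', c = some r') →
      ∃ r', E.foldl (fun r e => if decide (e.1 = q) && decide (e.2.1 = X) then some e.2.2 else r) c =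
        some r' from H none (.inl h)
  clear h
  induction E with
  | nil => intro c hc; simpa using hc
  | cons e E ih =>
    intro c hc
    refine ih _ ?_
    rcases hc with hc | ⟨r', hr'⟩
    · rcases List.mem_cons.1 hc with rfl | hc
      · exact .inr ⟨r, by simp⟩
      · exact .inl hc
    · refine .inr ?_
      beta_reduce
      split_ifs
      · exact ⟨_, rfl⟩
      · exact ⟨r', hr'⟩

/-- At most one action applies for each state and topmost symbol. -/
def Functional (A : List (Action Q G)) : Prop :=
  ∀ a ∈ A, ∀ a' ∈ A, a.1 = a'.1 → a.2.1 = a'.2.1 → a = a'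

theorem mem_improve {A : List (Action Q G)} {E : List (Q × G × Q)} {q : Q} {X : G} {r : Q} :
    (q, X, r) ∈ improve A E ↔
      ∃ a ∈ A, a.1 = q ∧ a.2.1 = X ∧ chain E (some a.2.2.2.1) a.2.2.2.2 = some r := by
  simp only [improve, List.mem_flatMap]
  refine exists_congr fun a => and_congr_right fun _ => ?_
  cases chain E (some a.2.2.2.1) a.2.2.2.2 with
  | none => simp
  | some s => simp [eq_comm]

theorem lookup_improve {A : List (Action Q G)} (hA : Functional A) {E : List (Q × G × Q)} {q : Q}
    {X : G} {r : Q} : lookup (improve A E) q X = some r ↔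
      ∃ a ∈ A, a.1 = q ∧ a.2.1 = X ∧ chain E (some a.2.2.2.1) a.2.2.2.2 = some r := by
  refine ⟨fun h => mem_improve.1 (lookup_mem h), fun h => ?_⟩
  obtain ⟨r', hr'⟩ := exists_lookup_of_mem (mem_improve.2 h)
  obtain ⟨a, ha, h1, h2, h3⟩ := h
  obtain ⟨a', ha', h1', h2', h3'⟩ := mem_improve.1 (lookup_mem hr')
  obtain rfl := hA a ha a' ha' (h1.trans h1'.symm) (h2.trans h2'.symm)
  rw [hr', ← h3', h3]

/-- The partial function given by `E` is extended by the one given by `E'`. -/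
def Extends (E E' : List (Q × G × Q)) : Prop :=
  ∀ q X r, lookup E q X = some r → lookup E' q X = some r

theorem Extends.chain {E E' : List (Q × G × Q)} (h : Extends E E') {c : Option Q} {β : List G} {r : Q}
    (hr : chain E c β = some r) : Construction.chain E' c β = some r := by
  induction β generalizing c with
  | nil => exact hr
  | cons Y β ih =>
    cases c with
    | none => simp [chainStep] at hr
    | some q =>
      rw [chain_cons, chainStep_some] at hr ⊢
      cases hs : lookup E q Y with
      | none => simp [hs] at hr
      | some s =>
        rw [h _ _ _ hs]
        exact ih (hs ▸ hr)

theorem Extends.improve {A : List (Action Q G)} (hA : Functional A) {E E' : List (Q × G × Q)}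
    (h : Extends E E') : Extends (improve A E) (improve A E') := by
  intro q X r hr
  obtain ⟨a, ha, h1, h2, h3⟩ := (lookup_improve hA).1 hr
  exact (lookup_improve hA).2 ⟨a, ha, h1, h2, h.chain h3⟩

theorem Extends.improve_sublist (A : List (Action Q G)) {E E' : List (Q × G × Q)}
    (h : Extends E E') : (Construction.improve A E).Sublist (Construction.improve A E') := by
  unfold Construction.improve
  induction A with
  | nil => simp
  | cons a A ih =>
    rw [List.flatMap_cons, List.flatMap_cons]
    refine List.Sublist.append ?_ ih
    cases hr : Construction.chain E (some a.2.2.2.1) a.2.2.2.2 with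
    | none => simp
    | some r => rw [h.chain hr]

/-- The iteration of `improve` becomes stationary within as many steps as there are actions, because
each step that changes the list makes it longer, and it never has more entries than there are
actions. -/
theorem improve_exits {A : List (Action Q G)} (hA : Functional A) :
    improve A (exits A) = exits A := by
  have hmono (k : ℕ) : Extends ((improve A)^[k] []) ((improve A)^[k + 1] []) := by
    induction k with
    | zero => intro q X r h; simp [lookup] at h
    | succ k ih =>
      rw [Function.iterate_succ_apply', Function.iterate_succ_apply' _ (k + 1)]
      exact ih.improve hA
  have hsub (k : ℕ) : ((improve A)^[k] []).Sublist ((improve A)^[k + 1] []) := by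
    cases k with
    | zero => simp
    | succ k =>
      rw [Function.iterate_succ_apply', Function.iterate_succ_apply' _ (k + 1)]
      exact (hmono k).improve_sublist A
  have key (k : ℕ) : (improve A)^[k + 1] [] = (improve A)^[k] [] ∨ k ≤ ((improve A)^[k] []).length := by
    induction k with
    | zero => simp
    | succ k ih =>
      rcases ih with ih | ih
      · left
        rw [Function.iterate_succ_apply' _ (k + 1), ih, ← Function.iterate_succ_apply' (improve A) k, ih]
      · by_cases heq : ((improve A)^[k] []).length = ((improve A)^[k + 1] []).length
        · left
          have := (hsub k).eq_of_length heq
          rw [Function.iterate_succ_apply' _ (k + 1), ← this, ← Function.iterate_succ_apply' (improve A) k,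
            ← this]
        · right
          have := (hsub k).length_le
          omega
  have hex : exits A = (improve A)^[A.length] [] := List.foldl_const _ _ _
  rw [hex, ← Function.iterate_succ_apply' (improve A)]
  rcases key A.length with h | h
  · exact h
  · refine ((hsub A.length).eq_of_length (le_antisymm (hsub A.length).length_le ?_)).symm
    rw [Function.iterate_succ_apply']
    exact (length_improve_le _ _).trans h

theorem lookup_exits {A : List (Action Q G)} (hA : Functional A) {q : Q} {X : G} {r : Q} :
    lookup (exits A) q X = some r ↔
      ∃ a ∈ A, a.1 = q ∧ a.2.1 = X ∧ chain (exits A) (some a.2.2.2.1) a.2.2.2.2 = some r := by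
  rw [← lookup_improve hA, improve_exits hA]

/-- The word of the variables `vp q Y` for the states `q` and symbols `Y` that occur when `β` is
popped, starting in the state `c`. -/
def word (E : List (Q × G × Q)) (vp : Q → G → V) : Option Q → List G → List (Option V)
  | _, [] => []
  | c, Y :: β => pathOut vp c Y ++ word E vp (chainStep E c Y) β

theorem path_eq (E : List (Q × G × Q)) (vp : Q → G → V) (s : Option Q × List (Option V))
    (β : List G) : path E vp s β = (chain E s.1 β, s.2 ++ word E vp s.1 β) := by
  induction β generalizing s with
  | nil => simp [path, word]
  | cons Y β ih =>
    refine (ih _).trans ?_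
    simp [pathStep, word]

theorem word_append (E : List (Q × G × Q)) (vp : Q → G → V) (c : Option Q) (β γ : List G) :
    word E vp c (β ++ γ) = word E vp c β ++ word E vp (chain E c β) γ := by
  induction β generalizing c with
  | nil => rfl
  | cons Y β ih => simp [word, ih]

theorem word_cons (E : List (Q × G × Q)) (vp : Q → G → V) (q : Q) (Y : G) (β : List G) :
    word E vp (some q) (Y :: β) = some (vp q Y) :: word E vp (lookup E q Y) β := rfl

theorem mem_accRules {E : List (Q × G × Q)} {vp va : Q → G → V} {v : V}
    {s : Option Q × List (Option V)} {β : List G} {r : Rule V} :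
    r ∈ accRules E vp va v s β ↔ ∃ β₁ Y q, β₁ ++ [Y] <+: β ∧ chain E s.1 β₁ = some q ∧
      r = (v, s.2 ++ word E vp s.1 β₁ ++ [some (va q Y)]) := by
  have hfst (β : List G) (o : List (Rule V)) :
      (β.foldl (fun s Y => (pathStep E vp s.1 Y, s.2 ++ accOut va v s.1 Y)) (s, o)).1 =
        path E vp s β := by
    unfold path
    induction β generalizing s o with
    | nil => rfl
    | cons Y β ih => exact ih _
  unfold accRules
  induction β using List.reverseRecOn with
  | nil => simp
  | append_singleton β Z ih =>
    rw [List.foldl_append, List.foldl_cons, List.foldl_nil]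
    simp only [List.mem_append, ih, hfst]
    constructor
    · rintro (⟨β₁, Y, q, h1, h2, h3⟩ | h)
      · exact ⟨β₁, Y, q, h1.trans (List.prefix_append _ _), h2, h3⟩
      · rw [accOut, path_eq] at h
        cases hc : chain E s.1 β with
        | none => simp [hc] at h
        | some q =>
          simp only [hc, Option.elim_some, List.mem_singleton] at h
          exact ⟨β, Z, q, List.prefix_refl _, hc, h⟩
    · rintro ⟨β₁, Y, q, h1, h2, h3⟩
      rcases List.prefix_concat_iff.1 h1 with h1 | h1
      · obtain ⟨rfl, h1⟩ := List.append_inj' h1 rfl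
        obtain rfl : Y = Z := by simpa using h1
        right
        rw [accOut, path_eq, h2, h3]
        simp
      · exact .inl ⟨β₁, Y, q, h1, h2, h3⟩

theorem mem_popRule {E : List (Q × G × Q)} {vp : Q → G → V} {v : V}
    {s : Option Q × List (Option V)} {β : List G} {r : Rule V} :
    r ∈ popRule v (path E vp s β) ↔ (∃ q, chain E s.1 β = some q) ∧
      r = (v, s.2 ++ word E vp s.1 β) := by
  rw [popRule, path_eq]
  cases chain E s.1 β <;> simp

end Exits

end Construction

/-! ### Languages generated by grammars -/

namespace ContextFreeGrammar

variable {T N : Type}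

/-- A word satisfies a sentential form with respect to sets of words assigned to the nonterminals if
it is obtained by replacing each nonterminal by a word from its set. -/
def Sat (V : N → List T → Prop) : List (Symbol T N) → List T → Prop
  | [], w => w = []
  | .terminal t :: α, w => ∃ w', w = t :: w' ∧ Sat V α w'
  | .nonterminal v :: α, w => ∃ w₁ w₂, w = w₁ ++ w₂ ∧ V v w₁ ∧ Sat V α w₂

theorem sat_append {V : N → List T → Prop} {α β : List (Symbol T N)} {w : List T} :
    Sat V (α ++ β) w ↔ ∃ w₁ w₂, w = w₁ ++ w₂ ∧ Sat V α w₁ ∧ Sat V β w₂ := by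
  induction α generalizing w with
  | nil => simp [Sat]
  | cons x α ih =>
    cases x with
    | terminal t =>
      simp only [List.cons_append, Sat, ih]
      constructor
      · rintro ⟨_, rfl, w₁, w₂, rfl, h1, h2⟩
        exact ⟨t :: w₁, w₂, rfl, ⟨w₁, rfl, h1⟩, h2⟩
      · rintro ⟨_, w₂, rfl, ⟨w₁, rfl, h1⟩, h2⟩
        exact ⟨w₁ ++ w₂, rfl, w₁, w₂, rfl, h1, h2⟩
    | nonterminal v =>
      simp only [List.cons_append, Sat, ih]
      constructor
      · rintro ⟨u, _, rfl, hu, w₁, w₂, rfl, h1, h2⟩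
        exact ⟨u ++ w₁, w₂, by simp, ⟨u, w₁, rfl, hu, h1⟩, h2⟩
      · rintro ⟨_, w₂, rfl, ⟨u, w₁, rfl, hu, h1⟩, h2⟩
        exact ⟨u, w₁ ++ w₂, by simp, hu, w₁, w₂, rfl, h1, h2⟩

theorem sat_terminals (V : N → List T → Prop) (w : List T) :
    Sat V (w.map Symbol.terminal) w := by
  induction w with
  | nil => rfl
  | cons t w ih => exact ⟨w, rfl, ih⟩

theorem sat_singleton {V : N → List T → Prop} {v : N} {w : List T} :
    Sat V [.nonterminal v] w ↔ V v w := by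
  simp [Sat]

/-- An assignment of sets of words to the nonterminals of a grammar is closed under the rules. -/
def Closed (g : ContextFreeGrammar T) (V : g.NT → List T → Prop) : Prop :=
  ∀ r ∈ g.rules, ∀ w, Sat V r.output w → V r.input w

variable {g : ContextFreeGrammar T}

theorem Closed.of_derives {V : g.NT → List T → Prop} (hV : g.Closed V) {v : g.NT} {w : List T}
    (h : g.Derives [.nonterminal v] (w.map .terminal)) : V v w := by
  suffices H : ∀ α, g.Derives α (w.map .terminal) → Sat V α w from sat_singleton.1 (H _ h)
  intro α hα
  induction hα using Relation.ReflTransGen.head_induction_on with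
  | refl => exact sat_terminals V w
  | head hp _ ih =>
    obtain ⟨r, hr, hrw⟩ := hp
    obtain ⟨x, y, rfl, rfl⟩ := hrw.exists_parts
    obtain ⟨_, w₃, rfl, h12, h3⟩ := sat_append.1 ih
    obtain ⟨w₁, w₂, rfl, h1, h2⟩ := sat_append.1 h12
    exact sat_append.2 ⟨_, w₃, rfl, sat_append.2 ⟨w₁, w₂, rfl, h1, sat_singleton.2 (hV r hr _ h2)⟩, h3⟩

/-- The sets of words derived from the nonterminals are closed under the rules. -/
theorem closed_derives (g : ContextFreeGrammar T) :
    g.Closed fun v w => g.Derives [.nonterminal v] (w.map .terminal) := by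
  intro r hr w hw
  have key (α : List (Symbol T g.NT)) : ∀ w,
      Sat (fun v w => g.Derives [.nonterminal v] (w.map .terminal)) α w →
        g.Derives α (w.map .terminal) := by
    induction α with
    | nil => rintro w rfl; exact Derives.refl _
    | cons x α ih =>
      cases x with
      | terminal t =>
        rintro _ ⟨w, rfl, h⟩
        simpa using (ih w h).append_left [.terminal t]
      | nonterminal v =>
        rintro _ ⟨w₁, w₂, rfl, h1, h2⟩
        have h1' := Derives.append_right h1 α
        have h2' := (ih w₂ h2).append_left (w₁.map .terminal)
        simpa using h1'.trans h2'
  exact Produces.trans_derives ⟨r, hr, ContextFreeRule.Rewrites.input_output⟩ (key _ w hw)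

end ContextFreeGrammar

/-! ### The grammar generates the language of the automaton -/

namespace PDA

variable {T : Type} {P : PDA T}

theorem MoveSeq.trans {I J K : P.ID} {u v : List T} (h : P.MoveSeq I u J) (h' : P.MoveSeq J v K) :
    P.MoveSeq I (u ++ v) K := by
  induction h with
  | nil I => exact h'
  | cons hm _ ih => rw [List.append_assoc]; exact .cons hm (ih h')

/-- What lies below on the stack does not matter. -/
theorem MoveSeq.frame {I J : P.ID} {w : List T} (h : P.MoveSeq I w J) (δ : List (Fin P.numSymbols)) :
    P.MoveSeq (I.1, I.2 ++ δ) w (J.1, J.2 ++ δ) := by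
  induction h with
  | nil I => exact .nil _
  | cons hm _ ih =>
    obtain ⟨a, ha, γ, hb, rfl, rfl⟩ := hm
    exact .cons ⟨a, ha, γ ++ δ, hb, rfl, by simp⟩ ih

theorem MoveSeq.of_action {a : PDAAction T (Fin P.numStates) (Fin P.numSymbols)} (ha : a ∈ P.actions)
    {γ : List (Fin P.numSymbols)} {w : List T} {J : P.ID}
    (h : P.MoveSeq (a.target, a.push ++ γ) w J) :
    P.MoveSeq (a.source, a.pop :: γ) (a.input.toList ++ w) J :=
  .cons ⟨a, ha, γ, rfl, rfl, rfl⟩ h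

end PDA

namespace Construction

open ContextFreeGrammar

/-- The symbol of a grammar described by an item on the right-hand side of a rule. -/
def toSymbol {V : Type} (s : Option V) : Symbol Unit V := s.elim (.terminal ()) .nonterminal

theorem functional_actionData (P : UDPDA) : Functional (P.1.actions.map actionData) := by
  obtain ⟨P, h1, h2⟩ := P
  intro a ha a' ha' hs hp
  obtain ⟨b, hb, rfl⟩ := List.mem_map.1 ha
  obtain ⟨b', hb', rfl⟩ := List.mem_map.1 ha'
  refine congrArg actionData (h1 b hb b' hb' hs hp ?_)
  cases hi : b.input with
  | none => exact (h2 b hb b' hb' hs hp hi).symm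
  | some _ =>
    cases hi' : b'.input with
    | none => simp [h2 b' hb' b hb hs.symm hp.symm hi'] at hi
    | some _ => rfl

section Language

variable {P : PDA Unit} {N : Type} {vp va : Fin P.numStates → Fin P.numSymbols → N} {vs : N}
  {E : List (Fin P.numStates × Fin P.numSymbols × Fin P.numStates)}

/-- The partial function given by `E` is a fixed point: `X` leads from `q` to `r` exactly if the word
pushed by the action for `(q, X)` leads from the target of this action to `r`. -/
def IsExit (P : PDA Unit) (E : List (Fin P.numStates × Fin P.numSymbols × Fin P.numStates)) : Prop :=
  ∀ q X r, lookup E q X = some r ↔ ∃ a ∈ P.actions, a.source = q ∧ a.pop = X ∧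
    chain E (some a.target) a.push = some r

/-- The input of an action as a word of terminal symbols. -/
def inputWord (b : Option Unit) : List (Symbol Unit N) := b.toList.map .terminal

theorem map_afterAction (a : PDAAction Unit (Fin P.numStates) (Fin P.numSymbols)) :
    (afterAction (V := N) (actionData a)).2.map toSymbol = inputWord a.input := by
  cases h : a.input <;> simp [afterAction, actionData, inputWord, toSymbol, h]

theorem sat_inputWord {V : N → List Unit → Prop} {b : Option Unit} {α : List (Symbol Unit N)}
    {w : List Unit} : Sat V (inputWord b ++ α) w ↔ ∃ w', w = b.toList ++ w' ∧ Sat V α w' := by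
  cases b <;> simp [inputWord, Sat]

variable (V : N → List Unit → Prop)

/-- The properties of an assignment of sets of words to variables that express that it is closed
under the rules. -/
structure ClosedUnder (P : PDA Unit) (vp va : Fin P.numStates → Fin P.numSymbols → N) (vs : N)
    (E : List (Fin P.numStates × Fin P.numSymbols × Fin P.numStates))
    (V : N → List Unit → Prop) : Prop where
  pop : ∀ a ∈ P.actions, ∀ r, chain E (some a.target) a.push = some r → ∀ w,
    Sat V ((word E vp (some a.target) a.push).map toSymbol) w →
      V (vp a.source a.pop) (a.input.toList ++ w)
  acc : ∀ a ∈ P.actions, ∀ β Y r, β ++ [Y] <+: a.push → chain E (some a.target) β = some r →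
    ∀ w₁ w₂, Sat V ((word E vp (some a.target) β).map toSymbol) w₁ → V (va r Y) w₂ →
      V (va a.source a.pop) (a.input.toList ++ (w₁ ++ w₂))
  final : ∀ q ∈ P.final, ∀ X, V (va q X) []
  start_acc : ∀ w, V (va P.start P.bottom) w → V vs w
  start_pop : ∀ r ∈ P.final, lookup E P.start P.bottom = some r →
    ∀ w, V (vp P.start P.bottom) w → V vs w

variable {V}

/-- The structure `ClosedUnder` says what closure means for the rules of the construction. -/
theorem closedUnder_iff {Γ : List (Fin P.numSymbols)} (hΓ : ∀ X, X ∈ Γ)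
    {A : List (Action (Fin P.numStates) (Fin P.numSymbols))}
    (hA : A = P.actions.map actionData) :
    (∀ r ∈ rules vp va vs P.start P.bottom P.final A Γ, ∀ w,
      Sat V (r.2.map toSymbol) w → V r.1 w) ↔ ClosedUnder P vp va vs (exits A) V := by
  subst hA
  constructor
  · intro h
    refine ⟨fun a ha r hr w hw => ?_, fun a ha β Y r hY hr w₁ w₂ h1 h2 => ?_, fun q hq X => ?_,
      fun w hw => ?_, fun r hr hl w hw => ?_⟩
    · refine h (vp a.source a.pop, (afterAction (actionData a)).2 ++
        word (exits (P.actions.map actionData)) vp (some a.target) a.push)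
        ?_ _ ?_
      · simp only [rules, List.mem_append, List.mem_flatMap, List.mem_map]
        exact .inr (.inr ⟨_, ⟨a, ha, rfl⟩,
          List.mem_append_left _ (mem_popRule.2 ⟨⟨r, hr⟩, rfl⟩)⟩)
      · rw [List.map_append, map_afterAction]
        exact sat_inputWord.2 ⟨w, rfl, hw⟩
    · refine h (va a.source a.pop, (afterAction (actionData a)).2 ++
        word (exits (P.actions.map actionData)) vp (some a.target) β ++
        [some (va r Y)]) ?_ _ ?_
      · simp only [rules, List.mem_append, List.mem_flatMap, List.mem_map]
        exact .inr (.inr ⟨_, ⟨a, ha, rfl⟩,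
          List.mem_append_right _ (mem_accRules.2 ⟨β, Y, r, hY, hr, rfl⟩)⟩)
      · rw [List.append_assoc, List.map_append, map_afterAction, List.map_append]
        exact sat_inputWord.2 ⟨_, rfl, sat_append.2 ⟨w₁, w₂, rfl, h1, sat_singleton.2 h2⟩⟩
    · refine h (va q X, []) ?_ _ rfl
      simp only [rules, List.mem_append, finalRules, List.mem_flatMap, List.mem_map]
      exact .inr (.inl ⟨q, hq, X, hΓ X, rfl⟩)
    · refine h (vs, [some (va P.start P.bottom)]) ?_ _ (sat_singleton.2 hw)
      simp [rules, startRules]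
    · refine h (vs, [some (vp P.start P.bottom)]) ?_ _ (sat_singleton.2 hw)
      simp only [rules, startRules, List.mem_append, List.mem_cons, hl, Option.elim_some,
        List.mem_flatMap]
      exact .inl (.inr ⟨r, hr, by simp⟩)
  · intro h r hr w hw
    simp only [rules, List.mem_append, List.mem_flatMap, List.mem_map, startRules, List.mem_cons,
      finalRules] at hr
    rcases hr with (rfl | hr) | ⟨q, hq, X, -, rfl⟩ | ⟨_, ⟨a, ha, rfl⟩, hr⟩
    · exact h.start_acc w (sat_singleton.1 hw)
    · cases hl : lookup (exits (P.actions.map actionData)) P.start P.bottom with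
      | none => simp [hl] at hr
      | some s =>
        simp only [hl, Option.elim_some, List.mem_flatMap] at hr
        obtain ⟨q, hq, hr⟩ := hr
        split_ifs at hr with hqs
        · obtain rfl : q = s := by simpa using hqs
          obtain rfl : r = _ := by simpa using hr
          exact h.start_pop q hq hl w (sat_singleton.1 hw)
        · simp at hr
    · obtain rfl : w = [] := hw
      exact h.final q hq X
    · rcases List.mem_append.1 hr with hr | hr
      · obtain ⟨⟨s, hs⟩, rfl⟩ := mem_popRule.1 hr
        rw [List.map_append, map_afterAction] at hw
        obtain ⟨w', rfl, hw'⟩ := sat_inputWord.1 hw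
        exact h.pop a ha s hs w' hw'
      · obtain ⟨β, Y, s, hY, hs, rfl⟩ := mem_accRules.1 hr
        rw [List.append_assoc, List.map_append, map_afterAction, List.map_append] at hw
        obtain ⟨w', rfl, hw'⟩ := sat_inputWord.1 hw
        obtain ⟨w₁, w₂, rfl, h1, h2⟩ := sat_append.1 hw'
        exact h.acc a ha β Y s hY hs w₁ w₂ h1 (sat_singleton.1 h2)

/-- The input of a computation that ends in a final state is generated by a word of variables: the
computation pops part of the stack and either ends at that moment, with an empty stack, or goes on
above the next stack symbol. -/
theorem ClosedUnder.of_final (hV : ClosedUnder P vp va vs E V) (hE : IsExit P E) {I J : P.ID}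
    {w : List Unit} (h : P.MoveSeq I w J) (hJ : J.1 ∈ P.final) :
    (∃ β Y r, β ++ [Y] <+: I.2 ∧ chain E (some I.1) β = some r ∧ ∃ w₁ w₂, w = w₁ ++ w₂ ∧
      Sat V ((word E vp (some I.1) β).map toSymbol) w₁ ∧ V (va r Y) w₂) ∨
    ∃ r ∈ P.final, chain E (some I.1) I.2 = some r ∧
      Sat V ((word E vp (some I.1) I.2).map toSymbol) w := by
  induction h with
  | nil I =>
    obtain ⟨q, β⟩ := I
    cases β with
    | nil => exact .inr ⟨q, hJ, rfl, rfl⟩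
    | cons Y β =>
      exact .inl ⟨[], Y, q, by simp, rfl, [], [], rfl, rfl, hV.final q hJ Y⟩
  | cons hm _ ih =>
    obtain ⟨a, ha, γ, rfl, rfl, rfl⟩ := hm
    simp only at ih ⊢
    -- If all of `a.push` is popped, then the word for `a.push` can be replaced by the variable for
    -- the pop of `a.pop`.
    have hpop {w₁ : List Unit} {s : Fin P.numStates} (hs : chain E (some a.target) a.push = some s)
        (hw₁ : Sat V ((word E vp (some a.target) a.push).map toSymbol) w₁) :
        lookup E a.source a.pop = some s ∧ V (vp a.source a.pop) (a.input.toList ++ w₁) :=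
      ⟨(hE _ _ _).2 ⟨a, ha, rfl, rfl, hs⟩, hV.pop a ha s hs w₁ hw₁⟩
    rcases ih hJ with ⟨β, Y, r, hY, hr, w₁, w₂, rfl, h1, h2⟩ | ⟨r, hr, hc, hw⟩
    · rcases List.prefix_or_prefix_of_prefix hY (List.prefix_append a.push γ) with hpre | hpre
      · exact .inl ⟨[], a.pop, a.source, by simp, rfl, [], _, rfl, rfl,
          hV.acc a ha β Y r hpre hr w₁ w₂ h1 h2⟩
      · rcases List.prefix_concat_iff.1 hpre with hpre' | ⟨δ, rfl⟩
        · exact .inl ⟨[], a.pop, a.source, by simp, rfl, [], _, rfl, rfl,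
            hV.acc a ha β Y r (by rw [hpre']) hr w₁ w₂ h1 h2⟩
        · rw [chain_append] at hr
          rw [word_append, List.map_append] at h1
          obtain ⟨u₁, u₂, rfl, hu₁, hu₂⟩ := sat_append.1 h1
          cases hs : chain E (some a.target) a.push with
          | none => simp [hs] at hr
          | some s =>
            obtain ⟨hl, hv⟩ := hpop hs hu₁
            rw [hs] at hr hu₂
            rw [List.append_assoc, List.prefix_append_right_inj] at hY
            refine .inl ⟨a.pop :: δ, Y, r, by simpa using hY, by simpa [hl] using hr,
              a.input.toList ++ u₁ ++ u₂, w₂, by simp, ?_, h2⟩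
            rw [word_cons, hl]
            exact ⟨_, u₂, rfl, hv, hu₂⟩
    · rw [chain_append] at hc
      rw [word_append, List.map_append] at hw
      obtain ⟨w₁, w₂, rfl, hw₁, hw₂⟩ := sat_append.1 hw
      cases hs : chain E (some a.target) a.push with
      | none => simp [hs] at hc
      | some s =>
        obtain ⟨hl, hv⟩ := hpop hs hw₁
        rw [hs] at hc hw₂
        refine .inr ⟨r, hr, by simpa [hl] using hc, ?_⟩
        rw [word_cons, hl]
        exact ⟨_, w₂, by simp, hv, hw₂⟩

theorem ClosedUnder.of_mem_language (hV : ClosedUnder P vp va vs E V) (hE : IsExit P E)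
    {w : List Unit} (h : w ∈ P.language) : V vs w := by
  obtain ⟨q, hq, β, h⟩ := h
  rcases hV.of_final hE h hq with ⟨β, Y, r, hY, hr, w₁, w₂, rfl, h1, h2⟩ | ⟨r, hr, hc, hw⟩
  · have hlen := hY.length_le
    simp only [List.length_append, List.length_singleton] at hlen
    obtain rfl : β = [] := List.length_eq_zero_iff.1 (by omega)
    obtain rfl : Y = P.bottom := by simpa using hY
    obtain rfl : P.start = r := by simpa using hr
    obtain rfl : w₁ = [] := h1
    exact hV.start_acc _ h2
  · exact hV.start_pop r hr (by simpa using hc) w (sat_singleton.1 hw)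

/-- Sets of words read by computations, which contain the words generated by the variables. A
computation in the second set may pop `X` with its last move, although `va q X` does not generate its
input; the larger set is simpler and as good for showing that only accepted words are generated. -/
def meaning (P : PDA Unit) (vp va : Fin P.numStates → Fin P.numSymbols → N) (vs : N)
    (E : List (Fin P.numStates × Fin P.numSymbols × Fin P.numStates)) (v : N) (w : List Unit) : Prop :=
  (∃ q X r, v = vp q X ∧ lookup E q X = some r ∧ P.MoveSeq (q, [X]) w (r, [])) ∨
  (∃ q X r β, v = va q X ∧ r ∈ P.final ∧ P.MoveSeq (q, [X]) w (r, β)) ∨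
  v = vs ∧ w ∈ P.language

/-- The variables of the three kinds are distinct. -/
structure Distinct {Q G : Type} (vp va : Q → G → N) (vs : N) : Prop where
  vp_inj : ∀ {q X q' X'}, vp q X = vp q' X' → q = q' ∧ X = X'
  va_inj : ∀ {q X q' X'}, va q X = va q' X' → q = q' ∧ X = X'
  vp_ne_va : ∀ {q X q' X'}, vp q X ≠ va q' X'
  vp_ne_vs : ∀ {q X}, vp q X ≠ vs
  va_ne_vs : ∀ {q X}, va q X ≠ vs

theorem meaning_vp (hd : Distinct vp va vs) {q X w} (h : meaning P vp va vs E (vp q X) w) :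
    ∃ r, lookup E q X = some r ∧ P.MoveSeq (q, [X]) w (r, []) := by
  rcases h with ⟨q', X', r, h1, h2⟩ | ⟨q', X', r, β, h1, -⟩ | ⟨h1, -⟩
  · obtain ⟨rfl, rfl⟩ := hd.vp_inj h1
    exact ⟨r, h2⟩
  · exact absurd h1 hd.vp_ne_va
  · exact absurd h1 hd.vp_ne_vs

theorem meaning_va (hd : Distinct vp va vs) {q X w} (h : meaning P vp va vs E (va q X) w) :
    ∃ r β, r ∈ P.final ∧ P.MoveSeq (q, [X]) w (r, β) := by
  rcases h with ⟨q', X', r, h1, -⟩ | ⟨q', X', r, β, h1, h2⟩ | ⟨h1, -⟩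
  · exact absurd h1.symm hd.vp_ne_va
  · obtain ⟨rfl, rfl⟩ := hd.va_inj h1
    exact ⟨r, β, h2⟩
  · exact absurd h1 hd.va_ne_vs

theorem moveSeq_of_sat_word (hd : Distinct vp va vs) {β : List (Fin P.numSymbols)} :
    ∀ {q r w}, chain E (some q) β = some r →
      Sat (meaning P vp va vs E) ((word E vp (some q) β).map toSymbol) w →
      P.MoveSeq (q, β) w (r, []) := by
  induction β with
  | nil =>
    intro q r w hr hw
    obtain rfl : q = r := by simpa using hr
    obtain rfl : w = [] := hw
    exact .nil _
  | cons Y β ih =>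
    intro q r w hr hw
    rw [word_cons] at hw
    obtain ⟨w₁, w₂, rfl, h1, h2⟩ := hw
    obtain ⟨s, hs, hm⟩ := meaning_vp hd h1
    rw [chain_cons, chainStep_some, hs] at hr
    rw [hs] at h2
    exact (hm.frame β).trans (ih hr h2)

theorem closedUnder_meaning (hd : Distinct vp va vs) (hE : IsExit P E) :
    ClosedUnder P vp va vs E (meaning P vp va vs E) where
  pop a ha r hr w hw := by
    refine .inl ⟨_, _, r, rfl, (hE _ _ _).2 ⟨a, ha, rfl, rfl, hr⟩, .of_action ha ?_⟩
    simpa using moveSeq_of_sat_word hd hr hw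
  acc a ha β Y r hY hr w₁ w₂ h1 h2 := by
    obtain ⟨δ, hδ⟩ := hY
    obtain ⟨s, γ, hs, hm⟩ := meaning_va hd h2
    refine .inr (.inl ⟨_, _, s, γ ++ δ, rfl, hs, .of_action ha ?_⟩)
    rw [← hδ]
    have := ((moveSeq_of_sat_word hd hr h1).frame ([Y] ++ δ)).trans (hm.frame δ)
    simpa using this
  final q hq X := .inr (.inl ⟨q, X, q, [X], rfl, hq, .nil _⟩)
  start_acc w hw := by
    obtain ⟨r, β, hr, hm⟩ := meaning_va hd hw
    exact .inr (.inr ⟨rfl, r, hr, β, hm⟩)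
  start_pop r hr hl w hw := by
    obtain ⟨s, hs, hm⟩ := meaning_vp hd hw
    obtain rfl : s = r := by simpa [hs] using hl
    exact .inr (.inr ⟨rfl, s, hr, [], hm⟩)

theorem mem_language_of_meaning (hd : Distinct vp va vs) {w : List Unit}
    (h : meaning P vp va vs E vs w) : w ∈ P.language := by
  rcases h with ⟨q', X', r, h1, -⟩ | ⟨q', X', r, β, h1, h2⟩ | ⟨-, h⟩
  · exact absurd h1.symm hd.vp_ne_vs
  · exact absurd h1.symm hd.va_ne_vs
  · exact h

end Language

end Construction

/-! ### Renaming states, stack symbols and variables -/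

namespace Construction

section Naturality

variable {Q G V Q' G' V' : Type} {f : Q → Q'} {g : G → G'} {h : V → V'} {vp va : Q → G → V}
  {vp' va' : Q' → G' → V'}

/-- The effect of a renaming on entries of the exit function. -/
def mapEntry (f : Q → Q') (g : G → G') (e : Q × G × Q) : Q' × G' × Q' := (f e.1, g e.2.1, f e.2.2)

/-- The effect of a renaming on rules. -/
def mapRule (h : V → V') (r : Rule V) : Rule V' := (h r.1, r.2.map (Option.map h))

/-- The effect of a renaming on the states of `path`. -/
def mapPath (f : Q → Q') (h : V → V') (s : Option Q × List (Option V)) :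
    Option Q' × List (Option V') :=
  (s.1.map f, s.2.map (Option.map h))

theorem accOut_map (ha : ∀ q X, va' (f q) (g X) = h (va q X)) (v : V)
    (s : Option Q × List (Option V)) (Y : G) :
    accOut va' (h v) (mapPath f h s) (g Y) = (accOut va v s Y).map (mapRule h) := by
  obtain ⟨c, w⟩ := s
  cases c with
  | none => rfl
  | some q => simp [accOut, mapPath, mapRule, ha]

theorem afterAction_map (a : Action Q G) :
    afterAction (V := V') (mapAction f g a) = mapPath f h (afterAction a) := by
  obtain ⟨a1, a2, b, a4, a5⟩ := a
  cases b <;> rfl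

variable [DecidableEq Q] [DecidableEq G] [DecidableEq Q'] [DecidableEq G']

theorem lookup_map (hf : Function.Injective f) (hg : Function.Injective g) (E : List (Q × G × Q))
    (q : Q) (X : G) : lookup (E.map (mapEntry f g)) (f q) (g X) = (lookup E q X).map f := by
  suffices H : ∀ c : Option Q, (E.map (mapEntry f g)).foldl
      (fun r e => if decide (e.1 = f q) && decide (e.2.1 = g X) then some e.2.2 else r) (c.map f) =
        (E.foldl (fun r e => if decide (e.1 = q) && decide (e.2.1 = X) then some e.2.2 else r)
          c).map f from H none
  induction E with
  | nil => intro c; rfl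
  | cons e E ih =>
    intro c
    rw [List.map_cons, List.foldl_cons, List.foldl_cons, ← ih]
    congr 1
    simp only [mapEntry, hf.eq_iff, hg.eq_iff]
    split_ifs <;> rfl

theorem chainStep_map (hf : Function.Injective f) (hg : Function.Injective g)
    (E : List (Q × G × Q)) (c : Option Q) (Y : G) :
    chainStep (E.map (mapEntry f g)) (c.map f) (g Y) = (chainStep E c Y).map f := by
  cases c with
  | none => rfl
  | some q => exact lookup_map hf hg E q Y

theorem chain_map (hf : Function.Injective f) (hg : Function.Injective g)
    (E : List (Q × G × Q)) (c : Option Q) (β : List G) :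
    chain (E.map (mapEntry f g)) (c.map f) (β.map g) = (chain E c β).map f := by
  induction β generalizing c with
  | nil => rfl
  | cons Y β ih =>
    rw [List.map_cons, chain_cons, chain_cons, chainStep_map hf hg]
    exact ih _

theorem improve_map (hf : Function.Injective f) (hg : Function.Injective g)
    (A : List (Action Q G)) (E : List (Q × G × Q)) :
    improve (A.map (mapAction f g)) (E.map (mapEntry f g)) = (improve A E).map (mapEntry f g) := by
  rw [improve, improve, List.map_flatMap, List.flatMap_map]
  congr 1
  funext a
  have := chain_map hf hg E (some a.2.2.2.1) a.2.2.2.2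
  simp only [mapAction]
  rw [Option.map_some] at this
  rw [this]
  cases chain E (some a.2.2.2.1) a.2.2.2.2 <;> rfl

theorem exits_map (hf : Function.Injective f) (hg : Function.Injective g) (A : List (Action Q G)) :
    exits (A.map (mapAction f g)) = (exits A).map (mapEntry f g) := by
  rw [exits, exits, List.foldl_map]
  suffices H : ∀ (l : List (Action Q G)) (E : List (Q × G × Q)),
      l.foldl (fun E _ => improve (A.map (mapAction f g)) E) (E.map (mapEntry f g)) =
        (l.foldl (fun E _ => improve A E) E).map (mapEntry f g) from H A []
  intro l
  induction l with
  | nil => intro E; rfl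
  | cons a l ih => intro E; rw [List.foldl_cons, List.foldl_cons, improve_map hf hg, ih]

theorem pathStep_map (hf : Function.Injective f) (hg : Function.Injective g)
    (hp : ∀ q X, vp' (f q) (g X) = h (vp q X)) (E : List (Q × G × Q))
    (s : Option Q × List (Option V)) (Y : G) :
    pathStep (E.map (mapEntry f g)) vp' (mapPath f h s) (g Y) = mapPath f h (pathStep E vp s Y) := by
  obtain ⟨c, w⟩ := s
  simp only [pathStep, mapPath, chainStep_map hf hg, List.map_append]
  congr 2
  cases c with
  | none => rfl
  | some q => simp [pathOut, hp]

theorem path_map (hf : Function.Injective f) (hg : Function.Injective g)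
    (hp : ∀ q X, vp' (f q) (g X) = h (vp q X)) (E : List (Q × G × Q))
    (s : Option Q × List (Option V)) (β : List G) :
    path (E.map (mapEntry f g)) vp' (mapPath f h s) (β.map g) = mapPath f h (path E vp s β) := by
  unfold path
  induction β generalizing s with
  | nil => rfl
  | cons Y β ih =>
    rw [List.map_cons, List.foldl_cons, List.foldl_cons, pathStep_map hf hg hp, ih]

theorem accRules_map (hf : Function.Injective f) (hg : Function.Injective g)
    (hp : ∀ q X, vp' (f q) (g X) = h (vp q X)) (ha : ∀ q X, va' (f q) (g X) = h (va q X))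
    (E : List (Q × G × Q)) (v : V) (s : Option Q × List (Option V)) (β : List G) :
    accRules (E.map (mapEntry f g)) vp' va' (h v) (mapPath f h s) (β.map g) =
      (accRules E vp va v s β).map (mapRule h) := by
  unfold accRules
  suffices H : ∀ (s : Option Q × List (Option V)) (o : List (Rule V)), (β.map g).foldl
      (fun s Y => (pathStep (E.map (mapEntry f g)) vp' s.1 Y, s.2 ++ accOut va' (h v) s.1 Y))
        (mapPath f h s, o.map (mapRule h)) =
      ((β.foldl (fun s Y => (pathStep E vp s.1 Y, s.2 ++ accOut va v s.1 Y)) (s, o)).map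
        (mapPath f h) (List.map (mapRule h))) from congrArg Prod.snd (H s [])
  induction β with
  | nil => intro s o; rfl
  | cons Y β ih =>
    intro s o
    rw [List.map_cons, List.foldl_cons, List.foldl_cons, ← ih]
    simp only [pathStep_map hf hg hp, accOut_map ha, List.map_append]

theorem actionRules_map (hf : Function.Injective f) (hg : Function.Injective g)
    (hp : ∀ q X, vp' (f q) (g X) = h (vp q X)) (ha : ∀ q X, va' (f q) (g X) = h (va q X))
    (E : List (Q × G × Q)) (a : Action Q G) :
    actionRules (E.map (mapEntry f g)) vp' va' (mapAction f g a) =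
      (actionRules E vp va a).map (mapRule h) := by
  rw [actionRules, actionRules, List.map_append, afterAction_map (h := h)]
  congr 1
  · have := path_map hf hg hp E (afterAction a) a.2.2.2.2
    simp only [mapAction]
    rw [this, hp]
    obtain ⟨c, w⟩ := path E vp (afterAction a) a.2.2.2.2
    cases c <;> rfl
  · have := accRules_map hf hg hp ha E (va a.1 a.2.1) (afterAction a) a.2.2.2.2
    rw [← ha] at this
    exact this

theorem rules_map (hf : Function.Injective f) (hg : Function.Injective g)
    (hp : ∀ q X, vp' (f q) (g X) = h (vp q X)) (ha : ∀ q X, va' (f q) (g X) = h (va q X))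
    (vs : V) (start : Q) (bottom : G) (F : List Q) (A : List (Action Q G)) (Γ : List G) :
    rules vp' va' (h vs) (f start) (g bottom) (F.map f) (A.map (mapAction f g)) (Γ.map g) =
      (rules vp va vs start bottom F A Γ).map (mapRule h) := by
  simp only [rules, List.map_append, exits_map hf hg]
  congr 1
  · simp only [startRules, List.map_cons, lookup_map hf hg]
    congr 1
    · simp [mapRule, ha]
    · cases lookup (exits A) start bottom with
      | none => rfl
      | some r =>
        simp only [Option.map_some, Option.elim_some, List.map_flatMap, List.flatMap_map,
          hf.eq_iff]
        congr 1
        funext q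
        split_ifs <;> simp [mapRule, hp]
  · congr 1
    · simp [finalRules, List.map_flatMap, List.flatMap_map, mapRule, ha, Function.comp_def]
    · rw [List.flatMap_map, List.map_flatMap]
      congr 1
      funext a
      exact actionRules_map hf hg hp ha _ a

end Naturality

/-! ### The grammar of an automaton -/

/-- The rule of a grammar that is described by the given data. -/
def toRule {V : Type} (r : Rule V) : ContextFreeRule Unit V := ⟨r.1, r.2.map toSymbol⟩

theorem pair_lt {n p : ℕ} (q : Fin n) (X : Fin p) : (q : ℕ) * p + X < n * p := by
  have h1 : ((q : ℕ) + 1) * p ≤ n * p := Nat.mul_le_mul_right p q.2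
  have h2 := X.2
  rw [Nat.add_mul] at h1
  omega

/-- The variable for the computations that pop `X` in state `q`. -/
def varPop {n p : ℕ} (q : Fin n) (X : Fin p) : Fin (2 * (n * p) + 1) :=
  ⟨q * p + X, by have := pair_lt q X; omega⟩

/-- The variable for the computations that start in state `q` with the stack `X` and reach a final state
before `X` has been popped. -/
def varAcc {n p : ℕ} (q : Fin n) (X : Fin p) : Fin (2 * (n * p) + 1) :=
  ⟨n * p + (q * p + X), by have := pair_lt q X; omega⟩

/-- The start variable. -/
def varStart (n p : ℕ) : Fin (2 * (n * p) + 1) := ⟨2 * (n * p), by omega⟩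

theorem distinct_vars (n p : ℕ) :
    Distinct (varPop (n := n) (p := p)) varAcc (varStart n p) := by
  have inj {q : Fin n} {X : Fin p} {q' : Fin n} {X' : Fin p}
      (h : (q : ℕ) * p + X = q' * p + X') : q = q' ∧ X = X' := by
    have h1 : ((q : ℕ) * p + X) / p = q := by
      rw [Nat.mul_comm, Nat.mul_add_div X.pos, Nat.div_eq_of_lt X.2, Nat.add_zero]
    have h2 : ((q' : ℕ) * p + X') / p = q' := by
      rw [Nat.mul_comm, Nat.mul_add_div X.pos, Nat.div_eq_of_lt X'.2, Nat.add_zero]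
    have h3 : (q : ℕ) = q' := by rw [← h1, h, h2]
    rw [h3] at h
    exact ⟨Fin.ext h3, Fin.ext (by omega)⟩
  refine ⟨fun {q X q' X'} h => ?_, fun {q X q' X'} h => ?_, fun {q X q' X'} h => ?_,
    fun {q X} h => ?_, fun {q X} h => ?_⟩
  · exact inj (by simpa [varPop] using h)
  · exact inj (by simpa [varAcc] using h)
  all_goals
    have h1 := pair_lt q X
    simp only [varPop, varAcc, varStart, Fin.mk.injEq] at h
    omega

/-- The grammar of a unary deterministic pushdown automaton. -/
def grammar (P : UDPDA) : CFGDescr Unit where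
  numVars := 2 * (P.1.numStates * P.1.numSymbols) + 1
  initial := varStart _ _
  rules := (rules varPop varAcc (varStart _ _) P.1.start P.1.bottom P.1.final
    (P.1.actions.map actionData) (List.finRange P.1.numSymbols)).map toRule

theorem language_grammar (P : UDPDA) : (grammar P).toCFG.language = P.1.language := by
  have hE : IsExit P.1 (exits (P.1.actions.map actionData)) := by
    intro q X r
    rw [lookup_exits (functional_actionData P)]
    simp only [List.mem_map, exists_exists_and_eq_and]
    rfl
  have hmem (r : ContextFreeRule Unit (Fin (grammar P).numVars)) :
      r ∈ (grammar P).toCFG.rules ↔ r ∈ (grammar P).rules := List.mem_toFinset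
  have hcl (V : Fin (2 * (P.1.numStates * P.1.numSymbols) + 1) → List Unit → Prop) :
      (grammar P).toCFG.Closed V ↔ ClosedUnder P.1 varPop varAcc (varStart _ _)
        (exits (P.1.actions.map actionData)) V := by
    rw [← closedUnder_iff (List.mem_finRange) rfl]
    constructor
    · intro h r hr w hw
      exact h (toRule r) ((hmem _).2 (List.mem_map_of_mem hr)) w hw
    · intro h r hr w hw
      obtain ⟨r', hr', rfl⟩ := List.mem_map.1 ((hmem r).1 hr)
      exact h r' hr' w hw
  have hd := distinct_vars P.1.numStates P.1.numSymbols
  ext w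
  rw [ContextFreeGrammar.mem_language_iff]
  constructor
  · intro h
    exact mem_language_of_meaning hd
      (((hcl _).2 (closedUnder_meaning hd hE)).of_derives (v := varStart _ _) h)
  · intro h
    exact ((hcl _).1 (ContextFreeGrammar.closed_derives _)).of_mem_language hE h

/-- The code of the grammar, in terms of numbers. -/
theorem encCFG_grammar (P : UDPDA) : Tok.encCFG (grammar P) =
    Tok.encNum (2 * (P.1.numStates * P.1.numSymbols) + 1) ++
      (Tok.encNum (2 * (P.1.numStates * P.1.numSymbols)) ++ Tok.encList encRule
        (rules (fun q X => q * P.1.numSymbols + X)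
          (fun q X => P.1.numStates * P.1.numSymbols + (q * P.1.numSymbols + X))
          (2 * (P.1.numStates * P.1.numSymbols)) (P.1.start : ℕ) (P.1.bottom : ℕ)
          (P.1.final.map Fin.val)
          (P.1.actions.map fun a => mapAction Fin.val Fin.val (actionData a))
          (List.range P.1.numSymbols))) := by
  have h1 := rules_map (f := Fin.val) (g := Fin.val) (h := Fin.val)
    (vp := varPop (n := P.1.numStates) (p := P.1.numSymbols)) (va := varAcc)
    (vp' := fun q X => q * P.1.numSymbols + X)
    (va' := fun q X => P.1.numStates * P.1.numSymbols + (q * P.1.numSymbols + X))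
    Fin.val_injective Fin.val_injective (fun _ _ => rfl) (fun _ _ => rfl) (varStart _ _)
    P.1.start P.1.bottom P.1.final (P.1.actions.map actionData) (List.finRange P.1.numSymbols)
  have h2 : (List.finRange P.1.numSymbols).map Fin.val = List.range P.1.numSymbols := by simp
  rw [h2, List.map_map] at h1
  have hsym {v : ℕ} (w : List (Option (Fin v))) :
      Tok.encList Tok.encSymbol (w.map toSymbol) =
        Tok.encList encSym (w.map (Option.map Fin.val)) := by
    induction w with
    | nil => rfl
    | cons s w ih =>
      rw [List.map_cons, List.map_cons, Tok.encList, Tok.encList, ih]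
      cases s <;> rfl
  have hrules {v : ℕ} (l : List (Rule (Fin v))) :
      Tok.encList Tok.encRule (l.map toRule) = Tok.encList encRule (l.map (mapRule Fin.val)) := by
    induction l with
    | nil => rfl
    | cons r l ih =>
      rw [List.map_cons, List.map_cons, Tok.encList, Tok.encList, ih]
      simp only [Tok.encRule, encRule, toRule, mapRule, hsym]
  rw [Tok.encCFG, grammar]
  simp only [hrules]
  rw [← h1]
  rfl

/-- An automaton is represented by the word that encodes it. -/
instance : Enc UDPDA := ⟨fun P => enc (Tok.encUDPDA P)⟩

theorem polyFn_encCFG_grammar : PolyFn fun P : UDPDA => Tok.encCFG (grammar P) := by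
  have ht : PolyFn fun P : UDPDA => Tok.encUDPDA P := PolyFn.recode fun _ => rfl
  have h0 : PolyFn fun P : UDPDA => (parse (false, .leaf) (Tok.encUDPDA P)).2 :=
    (polyFn_parse ht).snd
  have hparse (P : UDPDA) := congrArg Prod.snd (parse_encPDA P.1)
  have hn : PolyFn fun P : UDPDA => P.1.numStates :=
    h0.car.congr_enc fun P => by rw [Tok.encUDPDA, hparse]; rfl
  have hp : PolyFn fun P : UDPDA => P.1.numSymbols :=
    h0.cdr.car.congr_enc fun P => by rw [Tok.encUDPDA, hparse]; rfl
  have hs : PolyFn fun P : UDPDA => (P.1.start : ℕ) :=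
    h0.cdr.cdr.car.congr_enc fun P => by rw [Tok.encUDPDA, hparse]; rfl
  have hb : PolyFn fun P : UDPDA => (P.1.bottom : ℕ) :=
    h0.cdr.cdr.cdr.car.congr_enc fun P => by rw [Tok.encUDPDA, hparse]; rfl
  have hF : PolyFn fun P : UDPDA => P.1.final.map Fin.val :=
    h0.cdr.cdr.cdr.cdr.car.congr_enc fun P => by rw [Tok.encUDPDA, hparse]; rfl
  have hA : PolyFn fun P : UDPDA =>
      P.1.actions.map fun a => mapAction Fin.val Fin.val (actionData a) :=
    h0.cdr.cdr.cdr.cdr.cdr.car.congr_enc fun P => by rw [Tok.encUDPDA, hparse]; rfl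
  have hn' : PolyFn fun x : UDPDA × ℕ × ℕ => x.1.1.numStates := hn.comp (f := Prod.fst) (by fun_prop)
  have hp' : PolyFn fun x : UDPDA × ℕ × ℕ => x.1.1.numSymbols := hp.comp (f := Prod.fst) (by fun_prop)
  have hrules := polyFn_rules (α := UDPDA) (vp := fun P q X => q * P.1.numSymbols + X)
    (va := fun P q X => P.1.numStates * P.1.numSymbols + (q * P.1.numSymbols + X))
    (vs := fun P => 2 * (P.1.numStates * P.1.numSymbols)) (Γ := fun P => List.range P.1.numSymbols)
    (by fun_prop) (by fun_prop) (by fun_prop) hs hb hF hA (by fun_prop)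
  simp only [encCFG_grammar]
  exact PolyFn.append (by fun_prop)
    (PolyFn.append (by fun_prop) (PolyFn.encList hrules polyFn_encRule))

end Construction

/-- There are an algorithm, running in polynomial time on a Turing machine, and a constant `C` such
that, for every unary deterministic pushdown automaton `P` with `n` states and `p` stack symbols, the
algorithm computes from `P` a context-free grammar that has at most `C * (n * p)` variables and
generates the language that `P` accepts by final states. -/
theorem theorem4 :
    ∃ (f : UDPDA → CFGDescr Unit) (C : ℕ),
      Nonempty (Turing.TM2ComputableInPolyTime Tok.encUDPDA Tok.encCFG f) ∧
      ∀ P : UDPDA,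
        (f P).toCFG.language = P.1.language ∧
        (f P).numVars ≤ C * (P.1.numStates * P.1.numSymbols) := by
  refine ⟨Construction.grammar, 3,
    computableInPolyTime_of_polyFn (fun _ => rfl) Construction.polyFn_encCFG_grammar,
    fun P => ⟨Construction.language_grammar P, ?_⟩⟩
  -- There are a state and a stack symbol, so that the start variable is accounted for.
  have : 0 < P.1.numStates * P.1.numSymbols := Nat.mul_pos P.1.start.pos P.1.bottom.pos
  change 2 * (P.1.numStates * P.1.numSymbols) + 1 ≤ _
  omega
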